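/- A \emph{point configuration} is a finite multiset $\mathcal A\subset\mathbb R^d$ (repeated points are regarded as distinct, labelled elements) whose affine hull is $\mathbb R^d$. A \emph{face} of a subconfiguration $C\subseteq\mathcal A$ is either $C$ itself or a nonempty set $C\cap H$, where $H$ is a supporting hyperplane of $\operatorname{conv} C$. A \emph{subdivision} $\Sigma$ of $\mathcal A$ is a collection of nonempty subconfigurations of $\mathcal A$ such that (i) every face of a member of $\Sigma$ is in $\Sigma$; (ii) $\operatorname{conv}\mathcal A=\bigcup_{F\in\Sigma}\operatorname{conv}F$; (iii) $\operatorname{relint}(\operatorname{conv}F)\cap\operatorname{relint}(\operatorname{conv}G)=\emptyset$ for all distinct $F,G\in\Sigma$. The \emph{trivial} subdivision consists of all faces of $\mathcal A$, including $\mathcal A$. A subdivision $\Sigma'$ \emph{coarsens} $\Sigma$ if each member of $\Sigma$ is contained in some member of $\Sigma'$. A \emph{$4$-subdivision} is a non-trivial subdivision $\Sigma$ that is coarsened by no subdivision other than itself and the trivial one, and that has exactly four inclusion-maximal members. An \emph{interior face} of $\Sigma$ is an $F\in\Sigma$ with $\operatorname{conv}F\not\subseteq\partial\operatorname{conv}\mathcal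 A$. The \emph{tight span} of $\Sigma$ is the abstract polyhedral complex dual to the interior faces of $\Sigma$: its nonempty faces are the interior faces of $\Sigma$, ordered by reverse inclusion. \textbf{Lemma.} Let $\mathcal A$ be a point configuration and $\Sigma$ a $4$-subdivision of $\mathcal A$. Then the tight span of $\Sigma$ is isomorphic (that is, its poset of nonempty faces is isomorphic to that of the complex in question) to one of the following three simplicial complexes on the four vertices $0,1,2,3$: \begin{enumerate} \item the tetrahedron $\{0,1,2,3\}$ with all its faces; \item the complex of three triangles $\{0,1,2\},\{0,2,3\},\{0,1,3\}$ with the common vertex $0$; \item the complex of two triangles $\{0,1,2\},\{0,1,3\}$ glued along the edge $\{0,1\}$. \end{enumerate} -/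

import Mathlib

/-! Point configurations in `ℝ^d` are finite families `a : ι → EuclideanSpace ℝ (Fin d)`: a finite
multiset of points whose members are told apart by their labels. A subconfiguration is a set of
labels. -/

namespace PointConfig

variable {d : ℕ} {ι : Type*}

/-- The polytope spanned by the subconfiguration `F`. -/
def hull (a : ι → EuclideanSpace ℝ (Fin d)) (F : Set ι) : Set (EuclideanSpace ℝ (Fin d)) :=
  convexHull ℝ (a '' F)

/-- `F` is a (nonempty) face of the subconfiguration `C`: it consists of all elements of `C` on the
set `l = c`, where `l ≤ c` is a valid linear inequality for `C`. For `l ≠ 0` the set `l = c` is a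
supporting hyperplane; the case `l = 0` gives the improper face `C` itself. -/
def IsFace (a : ι → EuclideanSpace ℝ (Fin d)) (C F : Set ι) : Prop :=
  F.Nonempty ∧ ∃ (l : EuclideanSpace ℝ (Fin d) →L[ℝ] ℝ) (c : ℝ),
    (∀ i ∈ C, l (a i) ≤ c) ∧ F = {i ∈ C | l (a i) = c}

/-- `S` is a subdivision of the point configuration `a`. Cells are nonempty. -/
structure IsSubdivision (a : ι → EuclideanSpace ℝ (Fin d)) (S : Set (Set ι)) : Prop where
  nonempty : ∀ F ∈ S, F.Nonempty
  face_mem : ∀ C ∈ S, ∀ F, IsFace a C F → F ∈ S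
  iUnion_hull : ⋃ F ∈ S, hull a F = hull a Set.univ
  disjoint_relint : ∀ F ∈ S, ∀ G ∈ S, F ≠ G →
    Disjoint (intrinsicInterior ℝ (hull a F)) (intrinsicInterior ℝ (hull a G))

/-- The trivial subdivision: the whole configuration and all its faces. -/
def trivialSubdivision (a : ι → EuclideanSpace ℝ (Fin d)) : Set (Set ι) :=
  {F | IsFace a Set.univ F}

/-- `S` refines `T` (equivalently, `T` coarsens `S`). -/
def Refines (S T : Set (Set ι)) : Prop :=
  ∀ F ∈ S, ∃ G ∈ T, F ⊆ G

/-- A coarsest subdivision: a non-trivial subdivision whose only proper coarsening is the trivial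
subdivision. -/
structure IsCoarsestSubdivision (a : ι → EuclideanSpace ℝ (Fin d)) (S : Set (Set ι)) : Prop where
  isSubdivision : IsSubdivision a S
  ne_trivial : S ≠ trivialSubdivision a
  eq_or_eq_trivial : ∀ T, IsSubdivision a T → Refines S T → T = S ∨ T = trivialSubdivision a

/-- The inclusion-maximal cells of `S`. -/
def maximalCells (S : Set (Set ι)) : Set (Set ι) :=
  {F | Maximal (· ∈ S) F}

/-- A `k`-subdivision: a coarsest subdivision with exactly `k` maximal faces. -/
structure IsKSubdivision (a : ι → EuclideanSpace ℝ (Fin d)) (k : ℕ) (S : Set (Set ι)) : Prop where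
  isCoarsest : IsCoarsestSubdivision a S
  encard_maximalCells : (maximalCells S).encard = k

/-- The interior faces of `S`: the cells not entirely contained in the boundary of the polytope
spanned by the whole configuration (which is meant to be full-dimensional). -/
def interiorFaces (a : ι → EuclideanSpace ℝ (Fin d)) (S : Set (Set ι)) : Set (Set ι) :=
  {F ∈ S | ¬ hull a F ⊆ frontier (hull a Set.univ)}

/-- The tight span of `S`: the abstract polyhedral complex dual to the complex of interior faces,
given by its poset of nonempty faces. Its faces are the interior faces of `S`, ordered by reverse
inclusion; its vertices are the maximal cells of `S`. -/
abbrev TightSpan (a : ι → EuclideanSpace ℝ (Fin d)) (S : Set (Set ι)) : Type _ :=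
  (↥(interiorFaces a S))ᵒᵈ

/-- The poset of nonempty faces of the simplicial complex with vertices among `0, 1, 2, 3` whose
faces are the subsets of the members of `facets`. -/
abbrev FacePoset (facets : Finset (Finset (Fin 4))) : Type :=
  {s : Finset (Fin 4) // s.Nonempty ∧ ∃ t ∈ facets, s ⊆ t}

/-- A (solid) tetrahedron with all its faces. -/
def tetrahedron : Finset (Finset (Fin 4)) := {{0, 1, 2, 3}}

/-- Three triangles with the common vertex `0`, any two of which share an edge at `0`. -/
def threeTriangles : Finset (Finset (Fin 4)) := {{0, 1, 2}, {0, 2, 3}, {0, 1, 3}}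

/-- Two triangles glued along the edge `{0, 1}`. -/
def twoTriangles : Finset (Finset (Fin 4)) := {{0, 1, 2}, {0, 1, 3}}

end PointConfig

/-! ### Convex tilings: walls and the local structure at a point. -/

section ConvexTiling

open Set

variable {E : Type*} [NormedAddCommGroup E] [NormedSpace ℝ E]

/-! The four maximal cells of the subdivision tile the interior `U` of the polytope by convex bodies
meeting face to face. An interior face is determined by the set of maximal cells containing it, and
these sets are exactly the patterns: the index sets of the tiles through a point of `U`. So the
tight span is the poset of patterns, and it remains to see which families of patterns can occur.

Coarseness enters only through `Indecomposable`. If the tiles are grouped so that any two blocks are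
weakly separated by a hyperplane that they meet in the same set, the blocks and their faces form a
coarser subdivision (`IsSubdivision.merge`), which is excluded unless the grouping is trivial.

Four facts then determine the patterns. At a point of exactly three tiles all three pairs share
walls (`wall_of_three`). If every triple of tiles meets in `U`, so do all four, by a Helly-type
theorem for compact convex sets with convex union (`exists_mem_all_of_triples`). A wall that never
met a third tile would fill a whole hyperplane section of `U` and split the tiling in two
(`exists_third_of_wall`). Finally, if all four tiles meet, every triple also meets off the fourth
tile (`exists_triple`): otherwise all wall hyperplanes contain a common subspace of codimension two,
the tiles contain a cycle of walls around it, and a linear relation among consecutive wall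
functionals yields a forbidden grouping.

Hence either all nonempty sets are patterns, or the maximal patterns are two or three of the
triples, which gives the three complexes (`exists_perm_of_pattern_family`). -/

/-- A linear functional bounded above by `c` on a set is strictly below `c` on its interior. -/
theorem lt_of_mem_interior_of_le {s : Set E} {l : E →L[ℝ] ℝ} {c : ℝ} (hl : l ≠ 0)
    (h : ∀ y ∈ s, l y ≤ c) {x : E} (hx : x ∈ interior s) : l x < c := by
  have ho : IsOpenMap l := l.isOpenMap_of_ne_zero hl
  have h1 : l '' interior s ⊆ Iic c := by
    rintro _ ⟨y, hy, rfl⟩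
    exact h y (interior_subset hy)
  have h2 := interior_maximal h1 (ho _ isOpen_interior)
  rw [interior_Iic] at h2
  exact h2 ⟨x, hx, rfl⟩

theorem lt_of_mem_interior_of_ge {s : Set E} {l : E →L[ℝ] ℝ} {c : ℝ} (hl : l ≠ 0)
    (h : ∀ y ∈ s, c ≤ l y) {x : E} (hx : x ∈ interior s) : c < l x := by
  have := lt_of_mem_interior_of_le (l := -l) (c := -c) (neg_ne_zero.2 hl)
    (fun y hy => by simpa using h y hy) hx
  simpa using this

theorem exists_forall_abs_le_add_smul_mem {W : Set E} (hW : IsOpen W) {x : E} (hx : x ∈ W) (v : E) :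
    ∃ ε : ℝ, 0 < ε ∧ ε < 1 ∧ ∀ t : ℝ, |t| ≤ ε → x + t • v ∈ W := by
  have hc : Continuous fun t : ℝ => x + t • v := by fun_prop
  have h0 : (fun t : ℝ => x + t • v) ⁻¹' W ∈ nhds (0 : ℝ) :=
    (hW.preimage hc).mem_nhds (by simpa using hx)
  obtain ⟨r, hr, hb⟩ := Metric.mem_nhds_iff.1 h0
  refine ⟨min (r / 2) (1 / 2), by positivity, ?_, fun t ht => ?_⟩
  · exact (min_le_right _ _).trans_lt (by norm_num)
  · apply hb
    rw [Metric.mem_ball, Real.dist_eq, sub_zero]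
    exact (ht.trans (min_le_left _ _)).trans_lt (by linarith)

theorem exists_map_neg {l : E →L[ℝ] ℝ} (hl : l ≠ 0) : ∃ v, l v < 0 := by
  obtain ⟨v, hv⟩ := ContinuousLinearMap.exists_ne_zero hl
  rcases lt_or_gt_of_ne hv with h | h
  · exact ⟨v, h⟩
  · exact ⟨-v, by simpa using h⟩

/-- A point of `W` outside the closed set `S` could be pushed slightly in a direction decreasing
`l`, into the open half-space, while staying in `W` and outside `S`. -/
theorem mem_of_halfSpace_inter_subset {W S : Set E} (hW : IsOpen W) (hS : IsClosed S)
    {l : E →L[ℝ] ℝ} {c : ℝ} (hl : l ≠ 0) (h : {u | l u < c} ∩ W ⊆ S) {u : E} (hu : u ∈ W)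
    (huc : l u ≤ c) : u ∈ S := by
  obtain ⟨v, hv⟩ := exists_map_neg hl
  by_contra hui
  obtain ⟨ε, hε, -, h'⟩ := exists_forall_abs_le_add_smul_mem (hW.inter hS.isOpen_compl)
    (show u ∈ W ∩ Sᶜ from ⟨hu, hui⟩) v
  obtain ⟨h1, h2⟩ := h' ε (abs_of_pos hε).le
  refine h2 (h ⟨?_, h1⟩)
  simp only [mem_ofPred_eq, map_add, map_smul, smul_eq_mul]
  nlinarith

/-- Finitely many convex bodies with disjoint interiors that tile a convex open set and meet
face to face. -/
structure ConvexTiling {κ : Type*} (U : Set E) (P : κ → Set E) : Prop where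
  isOpen : IsOpen U
  convex_region : Convex ℝ U
  isClosed : ∀ i, IsClosed (P i)
  convex : ∀ i, Convex ℝ (P i)
  nonempty_interior : ∀ i, (interior (P i)).Nonempty
  disjoint : ∀ i j, i ≠ j → Disjoint (interior (P i)) (interior (P j))
  cover : U ⊆ ⋃ i, P i
  interior_subset_region : ∀ i, interior (P i) ⊆ U
  -- The face-to-face condition: `P i ∩ P j` is an extreme subset of `P i`.
  extreme : ∀ i j, ∀ y ∈ P i, ∀ z ∈ P i, ∀ w ∈ openSegment ℝ y z, w ∈ P j → y ∈ P j

namespace ConvexTiling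

variable {κ : Type*} {U : Set E} {P : κ → Set E}

/-- Two tiles share a wall: some point of the region lies in exactly these two tiles. -/
def Wall (U : Set E) (P : κ → Set E) (i j : κ) : Prop :=
  i ≠ j ∧ ∃ x ∈ U, ∀ k, x ∈ P k ↔ k = i ∨ k = j

theorem Wall.symm {E : Type*} {U : Set E} {P : κ → Set E} {i j : κ} (h : Wall U P i j) : Wall U P j i := by
  obtain ⟨hne, x, hx, hk⟩ := h
  exact ⟨hne.symm, x, hx, fun k => by rw [hk, or_comm]⟩

theorem closure_interior (T : ConvexTiling U P) (i : κ) : closure (interior (P i)) = P i := by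
  rw [(T.convex i).closure_interior_eq_closure_of_nonempty_interior (T.nonempty_interior i),
    (T.isClosed i).closure_eq]

theorem disjoint_interior (T : ConvexTiling U P) {i j : κ} (h : i ≠ j) :
    Disjoint (interior (P i)) (P j) := by
  rw [← T.closure_interior j]
  exact (T.disjoint i j h).closure_right isOpen_interior

theorem ge_of_forall_interior (T : ConvexTiling U P) {i : κ} {l : E →L[ℝ] ℝ} {c : ℝ}
    (h : ∀ y ∈ interior (P i), c ≤ l y) : ∀ y ∈ P i, c ≤ l y := by
  intro y hy
  rw [← T.closure_interior i] at hy
  have : closure (interior (P i)) ⊆ {y | c ≤ l y} :=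
    closure_minimal h (isClosed_le continuous_const l.continuous)
  exact this hy

theorem exists_separation (T : ConvexTiling U P) {i j : κ} (h : i ≠ j) :
    ∃ (l : E →L[ℝ] ℝ) (c : ℝ), l ≠ 0 ∧ (∀ y ∈ P i, l y ≤ c) ∧ ∀ y ∈ P j, c ≤ l y :=
  geometric_hahn_banach_of_nonempty_interior (T.convex i) (T.convex j) (T.disjoint_interior h)
    (T.nonempty_interior i) ((T.nonempty_interior j).mono interior_subset)

/-- Near a point of the region, only the tiles containing that point occur. -/
theorem exists_ball [Finite κ] (T : ConvexTiling U P) {x : E} (hx : x ∈ U) :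
    ∃ r > 0, Metric.ball x r ⊆ U ∧ ∀ y ∈ Metric.ball x r, ∀ k, y ∈ P k → x ∈ P k := by
  have h1 : ∀ k, ∀ᶠ y in nhds x, y ∈ P k → x ∈ P k := by
    intro k
    by_cases hk : x ∈ P k
    · exact Filter.Eventually.of_forall fun _ _ => hk
    · filter_upwards [(T.isClosed k).isOpen_compl.mem_nhds hk] with y hy hy'
      exact absurd hy' hy
  have h2 := (T.isOpen.eventually_mem hx).and (Filter.eventually_all.2 h1)
  obtain ⟨r, hr, h⟩ := Metric.eventually_nhds_iff_ball.1 h2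
  exact ⟨r, hr, fun y hy => (h y hy).1, fun y hy => (h y hy).2⟩

theorem exists_mem (T : ConvexTiling U P) {x : E} (hx : x ∈ U) : ∃ i, x ∈ P i := by
  simpa using T.cover hx

/-- A connected part of the region that leaves the tile `P i` does so through another tile. -/
theorem exists_mem_inter_of_isPreconnected [Finite κ] (T : ConvexTiling U P) {X : Set E}
    (hX : IsPreconnected X) (hXU : X ⊆ U) {i : κ} {z y : E} (hz : z ∈ X) (hzi : z ∈ P i)
    (hy : y ∈ X) (hyi : y ∉ P i) : ∃ w ∈ X, w ∈ P i ∧ ∃ j, j ≠ i ∧ w ∈ P j := by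
  have hcl : IsClosed (⋃ j ∈ {j | j ≠ i}, P j) :=
    (toFinite _).isClosed_biUnion fun j _ => T.isClosed j
  have hcov : X ⊆ P i ∪ ⋃ j ∈ {j | j ≠ i}, P j := by
    intro u hu
    obtain ⟨j, hj⟩ := T.exists_mem (hXU hu)
    by_cases h : j = i
    · exact Or.inl (h ▸ hj)
    · exact Or.inr (mem_biUnion (show j ∈ {j | j ≠ i} from h) hj)
  obtain ⟨w, hwX, hwi, hw⟩ := isPreconnected_closed_iff.1 hX _ _ (T.isClosed i) hcl hcov
    ⟨z, hz, hzi⟩ ⟨y, hy, (hcov hy).resolve_left hyi⟩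
  simp only [mem_iUnion] at hw
  obtain ⟨j, hj, hwj⟩ := hw
  exact ⟨w, hwX, hwi, j, hj, hwj⟩

theorem exists_interior_near (T : ConvexTiling U P) {i : κ} {x : E} (hx : x ∈ P i) {r : ℝ}
    (hr : 0 < r) : ∃ z ∈ interior (P i), z ∈ Metric.ball x r := by
  rw [← T.closure_interior i] at hx
  obtain ⟨z, hz, hd⟩ := Metric.mem_closure_iff.1 hx r hr
  exact ⟨z, hz, by rwa [Metric.mem_ball, dist_comm]⟩

theorem convex_lt_inter {B : Set E} (hB : Convex ℝ B) (l : E →L[ℝ] ℝ) (c : ℝ) :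
    Convex ℝ ({y | l y < c} ∩ B) :=
  (convex_halfSpace_lt l.toLinearMap.isLinear c).inter hB

/-- Around a point of exactly three tiles, any two of them share a wall. -/
theorem wall_of_three [Finite κ] (T : ConvexTiling U P) {i j k : κ} (hij : i ≠ j) (hik : i ≠ k)
    (hjk : j ≠ k) {x : E} (hx : x ∈ U) (hσ : ∀ m, x ∈ P m ↔ m = i ∨ m = j ∨ m = k) :
    Wall U P i j := by
  obtain ⟨r, hr, hBU, hB⟩ := T.exists_ball hx
  -- Without a wall between `i` and `j`, the tile `P i` fills the open half-ball cut off by a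
  -- hyperplane separating it from `P k`: an exit point from `P i` inside that half-ball avoids `P
  -- k`, so it would lie in exactly `P i` and `P j`.
  have key : ∀ {i j : κ}, i ≠ j → i ≠ k → (∀ m, x ∈ P m ↔ m = i ∨ m = j ∨ m = k) →
      ¬ Wall U P i j → ∃ (l : E →L[ℝ] ℝ) (c : ℝ), l ≠ 0 ∧ l x = c ∧ (∀ y ∈ P k, c ≤ l y) ∧
        {y | l y < c} ∩ Metric.ball x r ⊆ P i := by
    intro i j hij hik hσ hW
    obtain ⟨l, c, hl, hi, hk⟩ := T.exists_separation hik
    have hxc : l x = c := le_antisymm (hi x ((hσ i).2 (by simp))) (hk x ((hσ k).2 (by simp)))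
    refine ⟨l, c, hl, hxc, hk, fun y hy => ?_⟩
    by_contra hyi
    obtain ⟨z, hz, hzB⟩ := T.exists_interior_near ((hσ i).2 (by simp) : x ∈ P i) hr
    obtain ⟨w, ⟨hwl, hwB⟩, hwi, m, hmi, hwm⟩ := T.exists_mem_inter_of_isPreconnected
      (convex_lt_inter (convex_ball x r) l c).isPreconnected (fun u hu => hBU hu.2)
      ⟨lt_of_mem_interior_of_le hl hi hz, hzB⟩ (interior_subset hz) hy hyi
    have hwk : w ∉ P k := fun h => absurd (hk w h) (not_le.2 hwl)
    refine hW ⟨hij, w, hBU hwB, fun n => ⟨fun hn => ?_, ?_⟩⟩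
    · rcases (hσ n).1 (hB w hwB n hn) with h | h | h
      · exact Or.inl h
      · exact Or.inr h
      · exact absurd (h ▸ hn) hwk
    · rintro (rfl | rfl)
      · exact hwi
      · rcases (hσ m).1 (hB w hwB m hwm) with h | h | h
        · exact absurd h hmi
        · exact h ▸ hwm
        · exact absurd (h ▸ hwm) hwk
  by_contra hW
  obtain ⟨f, c, hf, hfx, hfk, hfi⟩ := key hij hik hσ hW
  obtain ⟨g, e, hg, hgx, hgk, hgj⟩ := key hij.symm hjk
    (fun m => by rw [hσ]; tauto) (fun h => hW h.symm)
  obtain ⟨z, hz, hzB⟩ := T.exists_interior_near ((hσ k).2 (by simp) : x ∈ P k) hr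
  have hO : IsOpen (({y | f y < c} ∩ Metric.ball x r) ∩ ({y | g y < e} ∩ Metric.ball x r)) :=
    ((isOpen_lt f.continuous continuous_const).inter Metric.isOpen_ball).inter
      ((isOpen_lt g.continuous continuous_const).inter Metric.isOpen_ball)
  have h1 := lt_of_mem_interior_of_ge hf hfk hz
  have h2 := lt_of_mem_interior_of_ge hg hgk hz
  -- Reflecting an interior point of `P k` through `x` lands in both half-balls, hence in the
  -- interiors of both `P i` and `P j`.
  have hmem : (2 : ℝ) • x - z ∈
      ({y | f y < c} ∩ Metric.ball x r) ∩ ({y | g y < e} ∩ Metric.ball x r) := by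
    have hb : (2 : ℝ) • x - z ∈ Metric.ball x r := by
      rw [Metric.mem_ball, dist_eq_norm] at hzB ⊢
      rwa [show (2 : ℝ) • x - z - x = -(z - x) by module, norm_neg]
    refine ⟨⟨?_, hb⟩, ⟨?_, hb⟩⟩
    · simp only [mem_ofPred_eq, map_sub, map_smul, smul_eq_mul]; linarith
    · simp only [mem_ofPred_eq, map_sub, map_smul, smul_eq_mul]; linarith
  exact (T.disjoint i j hij).le_bot
    ⟨interior_maximal (inter_subset_left.trans hfi) hO hmem,
      interior_maximal (inter_subset_right.trans hgj) hO hmem⟩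

/-- A separating functional of two tiles that share a wall cuts out the wall. -/
theorem mem_of_wall [Finite κ] (T : ConvexTiling U P) {i j : κ} (hW : Wall U P i j)
    {l : E →L[ℝ] ℝ} {c : ℝ} (hl : l ≠ 0) (hi : ∀ y ∈ P i, l y ≤ c) (hj : ∀ y ∈ P j, c ≤ l y)
    {y : E} (hy : y ∈ P i) (hyc : l y = c) : y ∈ P j := by
  obtain ⟨hij, x, hx, hσ⟩ := hW
  have hxc : l x = c := le_antisymm (hi x ((hσ i).2 (by simp))) (hj x ((hσ j).2 (by simp)))
  obtain ⟨r, hr, hBU, hB⟩ := T.exists_ball hx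
  have hsub : {u | l u < c} ∩ Metric.ball x r ⊆ P i := by
    rintro u ⟨hu, huB⟩
    obtain ⟨m, hm⟩ := T.exists_mem (hBU huB)
    rcases (hσ m).1 (hB u huB m hm) with h | h
    · exact h ▸ hm
    · exact absurd (hj u (h ▸ hm)) (not_le.2 hu)
  have hsub' : ∀ u ∈ Metric.ball x r, l u = c → u ∈ P i := fun u hu huc =>
    mem_of_halfSpace_inter_subset Metric.isOpen_ball (T.isClosed i) hl hsub hu huc.le
  -- Near `x` the whole hyperplane lies in `P i`. Prolonging the segment from `y` slightly beyond
  -- `x` therefore stays in `P i`, and since `x` is in `P j`, extremality carries `y` into `P j`.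
  obtain ⟨ε, hε, -, h⟩ := exists_forall_abs_le_add_smul_mem Metric.isOpen_ball
    (Metric.mem_ball_self (x := x) hr) (x - y)
  have hw := h ε (abs_of_pos hε).le
  have hwi : x + ε • (x - y) ∈ P i := hsub' _ hw (by simp [hxc, hyc])
  refine T.extreme i j y hy _ hwi x ?_ ((hσ j).2 (by simp))
  refine ⟨ε / (1 + ε), 1 / (1 + ε), by positivity, by positivity, by field_simp; ring, ?_⟩
  have : (1 + ε) ≠ 0 := by positivity
  apply smul_right_injective E this
  simp only [smul_add, smul_smul]
  field_simp
  module

end ConvexTiling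

end ConvexTiling

/-! ### A Helly-type theorem, and hyperplanes splitting a tiling. -/

section ConvexTiling

open Set

variable {E : Type*} [NormedAddCommGroup E] [NormedSpace ℝ E]

/-- Finitely many compact convex sets with convex union, any all but one of which have a common
point, have a common point. -/
theorem exists_forall_mem_of_convex_iUnion (n : ℕ) :
    ∀ C : Fin (n + 2) → Set E, (∀ i, IsCompact (C i)) → (∀ i, Convex ℝ (C i)) →
      Convex ℝ (⋃ i, C i) → (∀ i, ∃ x, ∀ j, j ≠ i → x ∈ C j) → ∃ x, ∀ i, x ∈ C i := by
  induction n with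
  | zero =>
    intro C hK _ hU hC
    obtain ⟨x, hx⟩ := hC 0
    obtain ⟨y, hy⟩ := hC 1
    obtain ⟨w, -, h0, h1⟩ := isPreconnected_closed_iff.1 hU.isPreconnected (C 0) (C 1)
      (hK 0).isClosed (hK 1).isClosed
      (by
        intro u hu
        obtain ⟨i, hi⟩ := mem_iUnion.1 hu
        fin_cases i
        · exact Or.inl hi
        · exact Or.inr hi)
      ⟨y, mem_iUnion.2 ⟨0, hy 0 (by decide)⟩, hy 0 (by decide)⟩
      ⟨x, mem_iUnion.2 ⟨1, hx 1 (by decide)⟩, hx 1 (by decide)⟩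
    refine ⟨w, fun i => ?_⟩
    fin_cases i
    · exact h0
    · exact h1
  | succ n ih =>
    intro C hK hC hU hne
    by_contra hno
    have hdisj : Disjoint (⋂ i : Fin (n + 2), C i.castSucc) (C (Fin.last _)) := by
      rw [Set.disjoint_left]
      intro x hx hl
      refine hno ⟨x, fun i => ?_⟩
      induction i using Fin.lastCases with
      | last => exact hl
      | cast i => exact mem_iInter.1 hx i
    obtain ⟨f, u, v, hu, huv, hv⟩ := geometric_hahn_banach_compact_closed
      (convex_iInter fun i : Fin (n + 2) => hC i.castSucc)
      ((hK (0 : Fin (n + 2)).castSucc).of_isClosed_subset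
        (isClosed_iInter fun i => (hK _).isClosed) (iInter_subset _ _))
      (hC (Fin.last _)) (hK (Fin.last _)).isClosed hdisj
    obtain ⟨d, hd⟩ := hne (Fin.last _)
    have hd' : ∀ i : Fin (n + 2), d ∈ C i.castSucc := fun i => hd _ (Fin.castSucc_lt_last i).ne
    have hcl : IsClosed {y | f y = u} := isClosed_eq f.continuous continuous_const
    have hcv : Convex ℝ {y | f y = u} := convex_hyperplane f.toLinearMap.isLinear u
    -- A hyperplane strictly separates the last set from the intersection of the others. The slices
    -- of the other sets satisfy the induction hypothesis: the last set misses the hyperplane, so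
    -- their union is a slice of the convex union. A common point of the slices would lie in the
    -- intersection, which is strictly below the hyperplane.
    obtain ⟨x, hx⟩ := ih (fun i => C i.castSucc ∩ {y | f y = u})
      (fun i => (hK _).inter_right hcl) (fun i => (hC _).inter hcv)
      (by
        have : (⋃ i : Fin (n + 2), C i.castSucc ∩ {y | f y = u}) = (⋃ i, C i) ∩ {y | f y = u} := by
          rw [← iUnion_inter]
          ext y
          constructor
          · rintro ⟨hy, hyu⟩
            obtain ⟨i, hi⟩ := mem_iUnion.1 hy
            exact ⟨mem_iUnion.2 ⟨_, hi⟩, hyu⟩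
          · rintro ⟨hy, hyu⟩
            obtain ⟨i, hi⟩ := mem_iUnion.1 hy
            refine ⟨?_, hyu⟩
            induction i using Fin.lastCases with
            | last => exact absurd hyu (huv.trans (hv y hi)).ne'
            | cast i => exact mem_iUnion.2 ⟨i, hi⟩
        rw [this]
        exact hU.inter hcv)
      (by
        intro i
        obtain ⟨e, he⟩ := hne i.castSucc
        have h1 : f d < u := hu d (mem_iInter.2 hd')
        have h2 : u < f e := huv.trans (hv e (he _ (Fin.castSucc_lt_last i).ne'))
        have h3 : 0 < f e - f d := by linarith
        have hw : f (((f e - u) / (f e - f d)) • d + ((u - f d) / (f e - f d)) • e) = u := by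
          simp only [map_add, map_smul, smul_eq_mul]
          field_simp
          ring
        -- The point where the segment from `d` to `e` crosses the hyperplane `f = u`.
        refine ⟨((f e - u) / (f e - f d)) • d + ((u - f d) / (f e - f d)) • e,
          fun j hj => ⟨hC _ (hd' j) (he _ fun h => hj (Fin.castSucc_injective _ h))
            (div_nonneg (by linarith) h3.le) (div_nonneg (by linarith) h3.le) ?_, hw⟩⟩
        field_simp
        ring)
    exact absurd (hx 0).2 (hu x (mem_iInter.2 fun i => (hx i).1)).ne

namespace ConvexTiling

variable {κ : Type*} {U : Set E}

/-- A hyperplane weakly separates two groups of tiles and meets both groups in the same set. -/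
def Separated (P : κ → Set E) (I J : Set κ) : Prop :=
  ∃ (l : E →L[ℝ] ℝ) (c : ℝ), l ≠ 0 ∧ (∀ i ∈ I, ∀ y ∈ P i, l y ≤ c) ∧
    (∀ j ∈ J, ∀ y ∈ P j, c ≤ l y) ∧ (∀ i ∈ I, ∀ y ∈ P i, l y = c → ∃ j ∈ J, y ∈ P j) ∧
    ∀ j ∈ J, ∀ y ∈ P j, l y = c → ∃ i ∈ I, y ∈ P i

theorem Separated.symm {P : κ → Set E} {I J : Set κ} (h : Separated P I J) : Separated P J I := by
  obtain ⟨l, c, hl, h1, h2, h3, h4⟩ := h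
  refine ⟨-l, -c, neg_ne_zero.2 hl, fun i hi y hy => by simpa using h2 i hi y hy,
    fun i hi y hy => by simpa using h1 i hi y hy,
    fun i hi y hy h => h4 i hi y hy (by simpa using h),
    fun i hi y hy h => h3 i hi y hy (by simpa using h)⟩

/-- No proper nontrivial grouping of the tiles has pairwise separated blocks. -/
def Indecomposable (P : κ → Set E) : Prop :=
  -- The blocks are the fibres of `β`; non-injective means that something is merged, non-constant
  -- that not everything is.
  ∀ β : κ → κ, ¬ Function.Injective β → (∃ i j, β i ≠ β j) →
    ¬ ∀ i j, β i ≠ β j → Separated P {k | β k = β i} {k | β k = β j}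

variable {P : Fin 4 → Set E}

/-- Intersecting the tiles with the convex hull of the four witnesses makes them compact; their
union is that hull, since it lies in `U`. -/
theorem exists_mem_all_of_triples (T : ConvexTiling U P)
    (h : ∀ i, ∃ x ∈ U, ∀ j, j ≠ i → x ∈ P j) : ∃ x ∈ U, ∀ i, x ∈ P i := by
  choose x hxU hx using h
  have hX : convexHull ℝ (range x) ⊆ U :=
    convexHull_min (range_subset_iff.2 hxU) T.convex_region
  have hXK : IsCompact (convexHull ℝ (range x)) := (finite_range x).isCompact_convexHull ℝ
  obtain ⟨y, hy⟩ := exists_forall_mem_of_convex_iUnion 2 (fun i => P i ∩ convexHull ℝ (range x))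
    (fun i => hXK.inter_left (T.isClosed i)) (fun i => (T.convex i).inter (convex_convexHull ℝ _))
    (by
      rw [← iUnion_inter, inter_eq_right.2 (hX.trans T.cover)]
      exact convex_convexHull ℝ _)
    (fun i => ⟨x i, fun j hj => ⟨hx i j hj, subset_convexHull ℝ _ ⟨i, rfl⟩⟩⟩)
  exact ⟨y, hX (hy 0).2, fun i => (hy i).1⟩

theorem exists_fourth : ∀ i j m : Fin 4, i ≠ j → i ≠ m → j ≠ m →
    ∃ n, n ≠ i ∧ n ≠ j ∧ n ≠ m ∧ ∀ k, k = i ∨ k = j ∨ k = m ∨ k = n := by decide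

/-- With one tile absent, `w` lies in exactly two or exactly three tiles; the first case is a wall
by definition, the second by `wall_of_three`. -/
theorem exists_wall_of_notMem (T : ConvexTiling U P) {i j m : Fin 4} (hij : i ≠ j) {w : E}
    (hw : w ∈ U) (hi : w ∈ P i) (hj : w ∈ P j) (hm : w ∉ P m) :
    ∃ k, w ∈ P k ∧ Wall U P i k := by
  have him : i ≠ m := fun h => hm (h ▸ hi)
  have hjm : j ≠ m := fun h => hm (h ▸ hj)
  obtain ⟨n, hni, hnj, hnm, hall⟩ := exists_fourth i j m hij him hjm
  refine ⟨j, hj, ?_⟩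
  by_cases hn : w ∈ P n
  · refine T.wall_of_three (k := n) hij hni.symm hnj.symm hw fun k => ⟨fun hk => ?_, ?_⟩
    · rcases hall k with h | h | h | h
      · exact Or.inl h
      · exact Or.inr (Or.inl h)
      · exact absurd (h ▸ hk) hm
      · exact Or.inr (Or.inr h)
    · rintro (rfl | rfl | rfl) <;> assumption
  · refine ⟨hij, w, hw, fun k => ⟨fun hk => ?_, ?_⟩⟩
    · rcases hall k with h | h | h | h
      · exact Or.inl h
      · exact Or.inr h
      · exact absurd (h ▸ hk) hm
      · exact absurd (h ▸ hk) hn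
    · rintro (rfl | rfl) <;> assumption

theorem subset_closure_region (T : ConvexTiling U P) (i : Fin 4) : P i ⊆ closure U := by
  rw [← T.closure_interior i]
  exact closure_mono (T.interior_subset_region i)

/-- In an indecomposable tiling every wall reaches a point of a third tile. -/
theorem exists_third_of_wall (T : ConvexTiling U P) (hP : Indecomposable P) {i j : Fin 4}
    (hW : Wall U P i j) : ∃ w ∈ U, w ∈ P i ∧ w ∈ P j ∧ ∃ k, k ≠ i ∧ k ≠ j ∧ w ∈ P k := by
  by_contra hno
  push Not at hno
  obtain ⟨l, c, hl, hli, hlj⟩ := T.exists_separation hW.1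
  obtain ⟨hij, x, hx, hσ⟩ := id hW
  have hxi : x ∈ P i := (hσ i).2 (by simp)
  have hxj : x ∈ P j := (hσ j).2 (by simp)
  have hxc : l x = c := le_antisymm (hli x hxi) (hlj x hxj)
  have hmi : ∀ y ∈ P i, l y = c → y ∈ P j := fun y hy hyc => T.mem_of_wall hW hl hli hlj hy hyc
  have hmj : ∀ y ∈ P j, l y = c → y ∈ P i := fun y hy hyc =>
    T.mem_of_wall hW.symm (l := -l) (c := -c) (neg_ne_zero.2 hl)
      (fun y hy => by simpa using hlj y hy) (fun y hy => by simpa using hli y hy) hy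
      (by simpa using hyc)
  -- The hyperplane section of `U` is connected and covered by the wall and the remaining tiles.
  -- These closed sets are disjoint inside it by assumption, so the wall is the whole section.
  have hX : ∀ y ∈ U, l y = c → y ∈ P i ∧ y ∈ P j := by
    intro y hy hyc
    by_contra hyn
    have hcl : IsClosed (⋃ k ∈ {k | k ≠ i ∧ k ≠ j}, P k) :=
      (toFinite _).isClosed_biUnion fun k _ => T.isClosed k
    have hcov : {y | l y = c} ∩ U ⊆ (P i ∩ P j) ∪ ⋃ k ∈ {k | k ≠ i ∧ k ≠ j}, P k := by
      rintro u ⟨huc, hu⟩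
      obtain ⟨k, hk⟩ := T.exists_mem hu
      by_cases h1 : k = i
      · subst h1
        exact Or.inl ⟨hk, hmi u hk huc⟩
      by_cases h2 : k = j
      · subst h2
        exact Or.inl ⟨hmj u hk huc, hk⟩
      · exact Or.inr (mem_biUnion (show k ∈ {k | k ≠ i ∧ k ≠ j} from ⟨h1, h2⟩) hk)
    have hcv : Convex ℝ ({y | l y = c} ∩ U) :=
      (convex_hyperplane l.toLinearMap.isLinear c).inter T.convex_region
    obtain ⟨w, ⟨-, hwU⟩, ⟨hwi, hwj⟩, hw⟩ := isPreconnected_closed_iff.1 hcv.isPreconnected _ _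
      ((T.isClosed i).inter (T.isClosed j)) hcl hcov ⟨x, ⟨hxc, hx⟩, hxi, hxj⟩
      ⟨y, ⟨hyc, hy⟩, (hcov ⟨hyc, hy⟩).resolve_left hyn⟩
    simp only [mem_iUnion] at hw
    obtain ⟨k, ⟨hki, hkj⟩, hk⟩ := hw
    exact hno w hwU hwi hwj k hki hkj hk
  -- The same for points on the boundary of `U`: the half-open segment from `x` runs inside `U`, and
  -- the tiles are closed.
  have hY : ∀ k, ∀ y ∈ P k, l y = c → y ∈ P i ∧ y ∈ P j := by
    intro k y hy hyc
    have h1 : openSegment ℝ x y ⊆ U := by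
      have := T.convex_region.openSegment_interior_closure_subset_interior
        (by rwa [T.isOpen.interior_eq]) (T.subset_closure_region k hy)
      rwa [T.isOpen.interior_eq] at this
    have h2 : openSegment ℝ x y ⊆ P i ∩ P j := by
      rintro u hu
      refine hX u (h1 hu) ?_
      obtain ⟨p, q, -, -, hpq, rfl⟩ := hu
      rw [map_add, map_smul, map_smul, hxc, hyc, ← add_smul, hpq, one_smul]
    have h3 : y ∈ closure (openSegment ℝ x y) := by
      rw [closure_openSegment]
      exact right_mem_segment ℝ x y
    exact closure_minimal h2 ((T.isClosed i).inter (T.isClosed j)) h3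
  choose z hz using T.nonempty_interior
  have hzc : ∀ k, l (z k) ≠ c := by
    intro k hk
    obtain ⟨h1, h2⟩ := hY k (z k) (interior_subset (hz k)) hk
    by_cases hki : k = i
    · subst hki
      exact (T.disjoint_interior hij).le_bot ⟨hz k, h2⟩
    · exact (T.disjoint_interior hki).le_bot ⟨hz k, h1⟩
  -- No tile crosses the hyperplane: the crossing point would be interior to `P k` and yet lie in
  -- both `P i` and `P j`.
  have hcross : ∀ k, ∀ y ∈ P k, ∀ p q : ℝ, 0 < p → 0 < q → p + q = 1 →
      p * l (z k) + q * l y ≠ c := by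
    intro k y hy p q hp hq hpq he
    have hu : p • z k + q • y ∈ interior (P k) :=
      (T.convex k).openSegment_interior_self_subset_interior (hz k) hy ⟨p, q, hp, hq, hpq, rfl⟩
    obtain ⟨h1, h2⟩ := hY k _ (interior_subset hu) (by simpa using he)
    by_cases hki : k = i
    · subst hki
      exact (T.disjoint_interior hij).le_bot ⟨hu, h2⟩
    · exact (T.disjoint_interior hki).le_bot ⟨hu, h1⟩
  have hlow : ∀ k, l (z k) < c → ∀ y ∈ P k, l y ≤ c := by
    intro k hk y hy
    by_contra h
    push Not at h
    have h3 : 0 < l y - l (z k) := by linarith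
    refine hcross k y hy ((l y - c) / (l y - l (z k))) ((c - l (z k)) / (l y - l (z k)))
      (div_pos (by linarith) h3) (div_pos (by linarith) h3) ?_ ?_ <;> field_simp <;> ring
  have hhigh : ∀ k, c < l (z k) → ∀ y ∈ P k, c ≤ l y := by
    intro k hk y hy
    by_contra h
    push Not at h
    have h3 : 0 < l (z k) - l y := by linarith
    refine hcross k y hy ((c - l y) / (l (z k) - l y)) ((l (z k) - c) / (l (z k) - l y))
      (div_pos (by linarith) h3) (div_pos (by linarith) h3) ?_ ?_ <;> field_simp <;> ring
  have hzi : l (z i) < c := lt_of_mem_interior_of_le hl hli (hz i)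
  have hzj : c < l (z j) := lt_of_mem_interior_of_ge hl hlj (hz j)
  have hsep : Separated P {k | l (z k) < c} {k | ¬ l (z k) < c} :=
    ⟨l, c, hl, fun k hk => hlow k hk,
      fun k hk => hhigh k (lt_of_le_of_ne (not_lt.1 hk) (hzc k).symm),
      fun k _ y hy h => ⟨j, hzj.not_gt, (hY k y hy h).2⟩,
      fun k _ y hy h => ⟨i, hzi, (hY k y hy h).1⟩⟩
  classical
  have hβ : ∀ k, (if l (z k) < c then i else j) = i ↔ l (z k) < c := by
    intro k
    split_ifs with h
    · simp [h]
    · simp [h, hij.symm]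
  have hβ' : ∀ k, (if l (z k) < c then i else j) = j ↔ ¬ l (z k) < c := by
    intro k
    split_ifs with h
    · simp [h, hij]
    · simp [h]
  refine hP (fun k => if l (z k) < c then i else j) (fun hinj => ?_) ⟨i, j, ?_⟩ ?_
  · have hcard := Finset.card_le_card_of_injOn (s := Finset.univ) (t := ({i, j} : Finset (Fin 4)))
      _ (fun k _ => by
        show (if l (z k) < c then i else j) ∈ _
        split_ifs <;> simp) hinj.injOn
    have := hcard.trans Finset.card_le_two
    simp at this
  · simp [hzi, hzj.not_gt, hij]
  · intro a b hab
    by_cases ha : l (z a) < c <;> by_cases hb : l (z b) < c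
    · simp [ha, hb] at hab
    · simpa only [if_pos ha, if_neg hb, hβ, hβ'] using hsep
    · simpa only [if_neg ha, if_pos hb, hβ, hβ'] using hsep.symm
    · simp [ha, hb] at hab

end ConvexTiling

end ConvexTiling

/-! ### Walls of tiles around a common point. -/

section ConvexTiling

open Set

variable {E : Type*} [NormedAddCommGroup E] [NormedSpace ℝ E]

/-- Three functionals vanishing on the common kernel of two functionals are linearly dependent. -/
theorem exists_linear_relation_of_ker_le {u u' a b c : E →L[ℝ] ℝ}
    (ha : ∀ v, u v = 0 → u' v = 0 → a v = 0) (hb : ∀ v, u v = 0 → u' v = 0 → b v = 0)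
    (hc : ∀ v, u v = 0 → u' v = 0 → c v = 0) :
    ∃ α β γ : ℝ, (α ≠ 0 ∨ β ≠ 0 ∨ γ ≠ 0) ∧ ∀ v, α * a v + β * b v + γ * c v = 0 := by
  classical
  let L : Fin 2 → E →ₗ[ℝ] ℝ := ![u.toLinearMap, u'.toLinearMap]
  let M : Fin 3 → E →ₗ[ℝ] ℝ := ![a.toLinearMap, b.toLinearMap, c.toLinearMap]
  have hmem : ∀ K : E →L[ℝ] ℝ, (∀ v, u v = 0 → u' v = 0 → K v = 0) →
      K.toLinearMap ∈ Submodule.span ℝ (range L) := by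
    intro K hK
    refine mem_span_of_iInf_ker_le_ker fun v hv => ?_
    rw [Submodule.mem_iInf] at hv
    exact hK v (hv 0) (hv 1)
  have hM : ¬ LinearIndependent ℝ M := by
    intro hli
    have h := linearIndependent_le_span' M hli (range L) (by
      rintro _ ⟨i, rfl⟩
      fin_cases i
      exacts [hmem a ha, hmem b hb, hmem c hc])
    have h2 : Fintype.card (range L) ≤ 2 := by simpa using Fintype.card_range_le L
    simp only [Cardinal.mk_fin] at h
    have h3 : (3 : ℕ) ≤ Fintype.card (range L) := by exact_mod_cast h
    omega
  obtain ⟨g, hg, i, hi⟩ := Fintype.not_linearIndependent_iff.1 hM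
  refine ⟨g 0, g 1, g 2, ?_, fun v => ?_⟩
  · fin_cases i
    exacts [Or.inl hi, Or.inr (Or.inl hi), Or.inr (Or.inr hi)]
  · have := LinearMap.congr_fun hg v
    simpa [Fin.sum_univ_three, M] using this

namespace ConvexTiling

variable {U : Set E}

/-- An antisymmetric choice of functionals separating the tiles pairwise. -/
structure Separating {κ : Type*} (P : κ → Set E) (h : κ → κ → E →L[ℝ] ℝ) (c : κ → κ → ℝ) :
    Prop where
  ne_zero : ∀ i j, i ≠ j → h i j ≠ 0
  le : ∀ i j, i ≠ j → ∀ y ∈ P i, h i j y ≤ c i j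
  ge : ∀ i j, i ≠ j → ∀ y ∈ P j, c i j ≤ h i j y
  neg : ∀ i j, i ≠ j → h j i = -h i j
  neg_const : ∀ i j, i ≠ j → c j i = -c i j

theorem exists_separating {κ : Type*} [LinearOrder κ] {P : κ → Set E} (T : ConvexTiling U P) :
    ∃ h c, Separating P h c := by
  choose l c hl h1 h2 using fun (i j : κ) (h : i ≠ j) => T.exists_separation h
  refine ⟨fun i j => if h : i < j then l i j h.ne else if h : j < i then -l j i h.ne else 0,
    fun i j => if h : i < j then c i j h.ne else if h : j < i then -c j i h.ne else 0,
    ?_, ?_, ?_, ?_, ?_⟩ <;> intro i j hij <;> rcases lt_or_gt_of_ne hij with h | h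
  · simpa [h] using hl i j hij
  · simpa [h, h.not_gt] using hl j i hij.symm
  · simpa [h] using h1 i j hij
  · simpa [h, h.not_gt] using h2 j i hij.symm
  · simpa [h] using h2 i j hij
  · simpa [h, h.not_gt] using h1 j i hij.symm
  · simp [h, h.not_gt]
  · simp [h, h.not_gt]
  · simp [h, h.not_gt]
  · simp [h, h.not_gt]

variable {P : Fin 4 → Set E} {h : Fin 4 → Fin 4 → E →L[ℝ] ℝ} {c : Fin 4 → Fin 4 → ℝ}

theorem Separating.eq_of_mem (hs : Separating P h c) {i j : Fin 4} (hij : i ≠ j) {y : E}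
    (hi : y ∈ P i) (hj : y ∈ P j) : h i j y = c i j :=
  le_antisymm (hs.le i j hij y hi) (hs.ge i j hij y hj)

theorem mem_of_wall_of_eq (T : ConvexTiling U P) (hs : Separating P h c) {i j : Fin 4}
    (hW : Wall U P i j) {y : E} (hy : y ∈ P i) (hyc : h i j y = c i j) : y ∈ P j :=
  T.mem_of_wall hW (hs.ne_zero i j hW.1) (hs.le i j hW.1) (hs.ge i j hW.1) hy hyc

theorem mem_of_wall_of_eq' (T : ConvexTiling U P) (hs : Separating P h c) {i j : Fin 4}
    (hW : Wall U P i j) {y : E} (hy : y ∈ P j) (hyc : h i j y = c i j) : y ∈ P i :=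
  T.mem_of_wall_of_eq hs hW.symm hy (by simp [hs.neg i j hW.1, hs.neg_const i j hW.1, hyc])

theorem exists_third : ∀ i j : Fin 4, ∃ l, l ≠ i ∧ l ≠ j := by decide

/-- If all tiles meet in a point of the region, then every tile has at least two walls. -/
theorem exists_second_wall (T : ConvexTiling U P) (hs : Separating P h c) {q : E} (hq : q ∈ U)
    (hqP : ∀ i, q ∈ P i) {i j : Fin 4} (hij : i ≠ j) : ∃ k, k ≠ j ∧ Wall U P i k := by
  by_contra hN
  push Not at hN
  have hf := hs.ne_zero i j hij
  have hfi := hs.le i j hij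
  have hfj := hs.ge i j hij
  have hnear : ∀ w ∈ U, w ∈ P i → w ∉ P j → ∀ m, w ∈ P m → m = i := by
    intro w hw hwi hwj m hm
    by_contra hmi
    obtain ⟨k, hk, hWk⟩ := T.exists_wall_of_notMem (Ne.symm hmi) hw hwi hm hwj
    exact hN k (fun h => hwj (h ▸ hk)) hWk
  -- If `P j` is the only possible wall neighbour of `P i`, then `P i` fills its whole side of the
  -- hyperplane, and all other tiles lie on the far side.
  have hlt : {y | h i j y < c i j} ∩ U ⊆ P i := by
    intro y hy
    by_contra hyi
    obtain ⟨z, hz⟩ := T.nonempty_interior i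
    obtain ⟨w, ⟨hwl, hwU⟩, hwi, m, hmi, hwm⟩ := T.exists_mem_inter_of_isPreconnected
      (convex_lt_inter T.convex_region (h i j) (c i j)).isPreconnected inter_subset_right
      ⟨lt_of_mem_interior_of_le hf hfi hz, T.interior_subset_region i hz⟩ (interior_subset hz)
      hy hyi
    exact hmi (hnear w hwU hwi (fun hwj => absurd (hfj w hwj) (not_le.2 hwl)) m hwm)
  have hle : ∀ y ∈ U, h i j y ≤ c i j → y ∈ P i := fun y hy hyc =>
    mem_of_halfSpace_inter_subset T.isOpen (T.isClosed i) hf hlt hy hyc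
  have hge : ∀ m, m ≠ i → ∀ y ∈ P m, c i j ≤ h i j y := by
    intro m hm
    refine T.ge_of_forall_interior fun y hy => ?_
    by_contra hlt'
    exact (T.disjoint_interior hm).le_bot
      ⟨hy, hlt ⟨not_le.1 hlt', T.interior_subset_region m hy⟩⟩
  obtain ⟨l, hli, hlj⟩ := exists_third i j
  obtain ⟨z, hz⟩ := T.nonempty_interior j
  obtain ⟨z', hz'⟩ := T.nonempty_interior l
  have hqc := hs.eq_of_mem hij (hqP i) (hqP j)
  have hqd := hs.eq_of_mem hlj.symm (hqP j) (hqP l)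
  have h1 := lt_of_mem_interior_of_ge hf hfj hz
  have h2 := lt_of_mem_interior_of_ge hf (hge l hli) hz'
  have h3 := lt_of_mem_interior_of_le (hs.ne_zero j l hlj.symm) (hs.le j l hlj.symm) hz
  have h4 := lt_of_mem_interior_of_ge (hs.ne_zero j l hlj.symm) (hs.ge j l hlj.symm) hz'
  -- a direction along the wall hyperplane leaving `P j`
  obtain ⟨v, hv, hv'⟩ : ∃ v, h i j v = 0 ∧ 0 < h j l v := by
    refine ⟨h i j (z - q) • (z' - q) - h i j (z' - q) • (z - q), ?_, ?_⟩
    · simp only [map_sub, map_smul, smul_eq_mul]; ring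
    · simp only [map_sub, map_smul, smul_eq_mul, hqc, hqd]
      have := mul_pos (sub_pos.2 h1) (sub_pos.2 h4)
      have := mul_pos (sub_pos.2 h2) (sub_pos.2 h3)
      linarith
  obtain ⟨ε, hε, -, hU⟩ := exists_forall_abs_le_add_smul_mem T.isOpen hq v
  have hyU := hU ε (abs_of_pos hε).le
  set y := q + ε • v with hy
  have hyc : h i j y = c i j := by simp [hy, hv, hqc]
  have hyi : y ∈ P i := hle y hyU hyc.le
  have hyj : y ∉ P j := by
    intro hyj
    have := hs.le j l hlj.symm y hyj
    rw [hy, map_add, map_smul, smul_eq_mul, hqd] at this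
    linarith [mul_pos hε hv']
  -- At `y` the only tile is `P i`, so it contains a neighbourhood of `y`; but `y` is on its
  -- bounding hyperplane.
  obtain ⟨r, hr, hBU, hB⟩ := T.exists_ball hyU
  obtain ⟨e, he⟩ := exists_map_neg hf
  obtain ⟨δ, hδ, -, hb⟩ := exists_forall_abs_le_add_smul_mem Metric.isOpen_ball
    (Metric.mem_ball_self (x := y) hr) (-e)
  have hb' := hb δ (abs_of_pos hδ).le
  obtain ⟨m, hm⟩ := T.exists_mem (hBU hb')
  have hmi := hnear y hyU hyi hyj m (hB _ hb' m hm)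
  rw [hmi] at hm
  have := hfi _ hm
  rw [map_add, map_smul, map_neg, smul_eq_mul, hyc] at this
  nlinarith

/-- If all tiles meet in a point of the region, then every tile is cut out by its walls. -/
theorem mem_of_forall_wall (T : ConvexTiling U P) (hs : Separating P h c) {q : E} (hq : q ∈ U)
    (hqP : ∀ i, q ∈ P i) {i : Fin 4} {y : E} (hy : y ∈ U)
    (hle : ∀ j, Wall U P i j → h i j y ≤ c i j) : y ∈ P i := by
  obtain ⟨z, hz⟩ := T.nonempty_interior i
  have hzlt : ∀ j, Wall U P i j → h i j z < c i j := fun j hj =>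
    lt_of_mem_interior_of_le (hs.ne_zero i j hj.1) (hs.le i j hj.1) hz
  have hzU := T.interior_subset_region i hz
  have hcv : Convex ℝ ({u | ∀ j, Wall U P i j → h i j u < c i j} ∩ U) := by
    refine Convex.inter ?_ T.convex_region
    have : {u | ∀ j, Wall U P i j → h i j u < c i j} =
        ⋂ j, ⋂ _ : Wall U P i j, {u | h i j u < c i j} := by
      ext; simp
    rw [this]
    exact convex_iInter₂ fun j _ => convex_halfSpace_lt (h i j).toLinearMap.isLinear _
  -- An exit point from `P i` lies in some wall neighbour of `P i`, contradicting the strict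
  -- inequality for that wall. At a point of all four tiles the neighbour comes from
  -- `exists_second_wall`.
  have hX : {u | ∀ j, Wall U P i j → h i j u < c i j} ∩ U ⊆ P i := by
    intro u hu
    by_contra hui
    obtain ⟨w, ⟨hwl, hwU⟩, hwi, m, hmi, hwm⟩ := T.exists_mem_inter_of_isPreconnected
      hcv.isPreconnected inter_subset_right ⟨hzlt, hzU⟩ (interior_subset hz) hu hui
    obtain ⟨k, hk, hW⟩ : ∃ k, w ∈ P k ∧ Wall U P i k := by
      by_cases hall : ∀ n, w ∈ P n
      · obtain ⟨k, -, hW⟩ := T.exists_second_wall hs hq hqP (Ne.symm hmi)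
        exact ⟨k, hall k, hW⟩
      · push Not at hall
        obtain ⟨n, hn⟩ := hall
        exact T.exists_wall_of_notMem (Ne.symm hmi) hwU hwi hwm hn
    exact absurd (hs.ge i k hW.1 w hk) (not_le.2 (hwl k hW))
  have hsub : openSegment ℝ z y ⊆ P i := by
    rintro u hu
    refine hX ⟨fun j hj => ?_, T.convex_region.openSegment_subset hzU hy hu⟩
    obtain ⟨p, s, hp, hs', hps, rfl⟩ := hu
    have h1 := mul_lt_mul_of_pos_left (hzlt j hj) hp
    have h2 := mul_le_mul_of_nonneg_left (hle j hj) hs'.le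
    have h3 : c i j = p * c i j + s * c i j := by rw [← add_mul, hps, one_mul]
    simp only [map_add, map_smul, smul_eq_mul]
    linarith
  refine closure_minimal hsub (T.isClosed i) ?_
  rw [closure_openSegment]
  exact right_mem_segment ℝ z y

/-- If all tiles meet in a point of the region but some three tiles meet nowhere else, then the
wall hyperplanes contain a common subspace of codimension at most two. -/
theorem exists_ker_le_of_no_triple (T : ConvexTiling U P) (hs : Separating P h c) {q : E}
    (hq : q ∈ U) (hqP : ∀ i, q ∈ P i) {l : Fin 4}
    (hno : ¬ ∃ x ∈ U, ∀ m, x ∈ P m ↔ m ≠ l) :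
    ∃ u u' : E →L[ℝ] ℝ, ∀ m n, Wall U P m n → ∀ v, u v = 0 → u' v = 0 → h m n v = 0 := by
  obtain ⟨i, j, k, hij, hik, hil, hjk, hjl, hkl, hall⟩ : ∃ i j k : Fin 4, i ≠ j ∧ i ≠ k ∧ i ≠ l ∧
      j ≠ k ∧ j ≠ l ∧ k ≠ l ∧ ∀ m, m = i ∨ m = j ∨ m = k ∨ m = l := by
    clear hno; revert l; decide
  have hqc : ∀ m n, Wall U P m n → h m n q = c m n := fun m n hW =>
    hs.eq_of_mem hW.1 (hqP m) (hqP n)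
  obtain ⟨u, u', hu⟩ : ∃ u u' : E →L[ℝ] ℝ, ∀ v, u v = 0 → u' v = 0 → ∀ m, Wall U P i m →
      h i m v = 0 := by
    by_cases hWj : Wall U P i j
    · by_cases hWk : Wall U P i k
      · refine ⟨h i j, h i k, ?_⟩
        -- A direction violating this would move `q` to a point of `P i`, `P j` and `P k` off `P l`.
        -- Applied to `v` and `-v`, it gives `h i l v = 0`.
        have key : ∀ v, h i j v = 0 → h i k v = 0 → Wall U P i l → 0 ≤ h i l v := by
          intro v hvj hvk hWl
          by_contra hlt
          obtain ⟨ε, hε, -, hU⟩ := exists_forall_abs_le_add_smul_mem T.isOpen hq v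
          have hyU := hU ε (abs_of_pos hε).le
          have hylt : h i l (q + ε • v) < c i l := by
            simp only [map_add, map_smul, smul_eq_mul, hqc i l hWl]
            nlinarith
          have hyj : h i j (q + ε • v) = c i j := by simp [hvj, hqc i j hWj]
          have hyk : h i k (q + ε • v) = c i k := by simp [hvk, hqc i k hWk]
          have hyi : q + ε • v ∈ P i := T.mem_of_forall_wall hs hq hqP hyU fun m hm => by
            rcases hall m with rfl | rfl | rfl | rfl
            · exact absurd rfl hm.1
            · exact hyj.le
            · exact hyk.le
            · exact hylt.le
          refine hno ⟨_, hyU, fun m => ⟨fun hm hml => ?_, fun hm => ?_⟩⟩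
          · exact absurd (hs.ge i l hil _ (hml ▸ hm)) (not_le.2 hylt)
          · rcases hall m with rfl | rfl | rfl | rfl
            · exact hyi
            · exact T.mem_of_wall_of_eq hs hWj hyi hyj
            · exact T.mem_of_wall_of_eq hs hWk hyi hyk
            · exact absurd rfl hm
        intro v hvj hvk m hm
        rcases hall m with rfl | rfl | rfl | rfl
        · exact absurd rfl hm.1
        · exact hvj
        · exact hvk
        · have h1 := key v hvj hvk hm
          have h2 := key (-v) (by simpa using hvj) (by simpa using hvk) hm
          rw [map_neg] at h2
          linarith
      · refine ⟨h i j, h i l, fun v hvj hvl m hm => ?_⟩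
        rcases hall m with rfl | rfl | rfl | rfl
        exacts [absurd rfl hm.1, hvj, absurd hm hWk, hvl]
    · refine ⟨h i k, h i l, fun v hvk hvl m hm => ?_⟩
      rcases hall m with rfl | rfl | rfl | rfl
      exacts [absurd rfl hm.1, absurd hm hWj, hvk, hvl]
  refine ⟨u, u', fun m n hW v hv hv' => ?_⟩
  -- Both `q + ε • v` and `q - ε • v` stay in `P i`; their midpoint `q` is in every tile, so
  -- extremality puts `q + ε • v` in every tile and all wall functionals vanish on `v`.
  obtain ⟨ε, hε, -, hU⟩ := exists_forall_abs_le_add_smul_mem T.isOpen hq v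
  have hmem : ∀ t : ℝ, |t| ≤ ε → q + t • v ∈ P i := fun t ht =>
    T.mem_of_forall_wall hs hq hqP (hU t ht) fun m hm => by simp [hu v hv hv' m hm, hqc i m hm]
  have hmem' : ∀ m, q + ε • v ∈ P m := fun m => by
    refine T.extreme i m _ (hmem ε (abs_of_pos hε).le) _
      (hmem (-ε) (by rw [abs_neg]; exact (abs_of_pos hε).le)) q
      ⟨1 / 2, 1 / 2, by norm_num, by norm_num, by norm_num, by module⟩ (hqP m)
  have := hs.eq_of_mem hW.1 (hmem' m) (hmem' n)
  rw [map_add, hqc m n hW, map_smul, smul_eq_mul] at this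
  rcases mul_eq_zero.1 (show ε * h m n v = 0 by linarith) with h0 | h0
  · exact absurd h0 hε.ne'
  · exact h0

end ConvexTiling

end ConvexTiling

/-! ### Cycles of walls and the forbidden groupings they produce. -/

section ConvexTiling

open Set

variable {E : Type*} [NormedAddCommGroup E] [NormedSpace ℝ E]

namespace ConvexTiling

variable {U : Set E} {P : Fin 4 → Set E} {h : Fin 4 → Fin 4 → E →L[ℝ] ℝ} {c : Fin 4 → Fin 4 → ℝ}

theorem Separating.sub_nonpos (hs : Separating P h c) {q : E} (hqP : ∀ i, q ∈ P i) {i j : Fin 4}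
    (hij : i ≠ j) {y : E} (hy : y ∈ P i) : h i j (y - q) ≤ 0 := by
  have := hs.le i j hij y hy
  rw [map_sub, hs.eq_of_mem hij (hqP i) (hqP j)]
  linarith

theorem Separating.sub_nonneg (hs : Separating P h c) {q : E} (hqP : ∀ i, q ∈ P i) {i j : Fin 4}
    (hij : i ≠ j) {y : E} (hy : y ∈ P j) : 0 ≤ h i j (y - q) := by
  have := hs.ge i j hij y hy
  rw [map_sub, hs.eq_of_mem hij (hqP i) (hqP j)]
  linarith

theorem mem_of_wall_of_sub_eq_zero (T : ConvexTiling U P) (hs : Separating P h c) {q : E}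
    (hqP : ∀ i, q ∈ P i) {i j : Fin 4} (hW : Wall U P i j) {y : E} (hy : y ∈ P i)
    (h0 : h i j (y - q) = 0) : y ∈ P j := by
  refine T.mem_of_wall_of_eq hs hW hy ?_
  rw [map_sub, hs.eq_of_mem hW.1 (hqP i) (hqP j)] at h0
  linarith

theorem mem_of_wall_of_sub_eq_zero' (T : ConvexTiling U P) (hs : Separating P h c) {q : E}
    (hqP : ∀ i, q ∈ P i) {i j : Fin 4} (hW : Wall U P i j) {y : E} (hy : y ∈ P j)
    (h0 : h i j (y - q) = 0) : y ∈ P i := by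
  refine T.mem_of_wall_of_eq' hs hW hy ?_
  rw [map_sub, hs.eq_of_mem hW.1 (hqP i) (hqP j)] at h0
  linarith

/-- A criterion for separation in terms of a functional centred at a common point. -/
theorem separated_of_sub {κ : Type*} {P : κ → Set E} {I J : Set κ} {l : E →L[ℝ] ℝ} (q : E)
    (hl : l ≠ 0)
    (hI : ∀ i ∈ I, ∀ y ∈ P i, l (y - q) ≤ 0 ∧ (l (y - q) = 0 → ∃ j ∈ J, y ∈ P j))
    (hJ : ∀ j ∈ J, ∀ y ∈ P j, 0 ≤ l (y - q) ∧ (l (y - q) = 0 → ∃ i ∈ I, y ∈ P i)) :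
    Separated P I J := by
  refine ⟨l, l q, hl, fun i hi y hy => ?_, fun j hj y hy => ?_, fun i hi y hy h => ?_,
    fun j hj y hy h => ?_⟩
  · simpa [sub_nonpos] using (hI i hi y hy).1
  · simpa [sub_nonneg] using (hJ j hj y hy).1
  · exact (hI i hi y hy).2 (by rw [map_sub, h, sub_self])
  · exact (hJ j hj y hy).2 (by rw [map_sub, h, sub_self])

theorem separated_singleton_of_wall (T : ConvexTiling U P) (hs : Separating P h c) {q : E}
    (hqP : ∀ i, q ∈ P i) {i j : Fin 4} (hW : Wall U P i j) : Separated P {i} {j} := by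
  refine separated_of_sub q (hs.ne_zero i j hW.1) ?_ ?_
  · rintro _ rfl y hy
    exact ⟨hs.sub_nonpos hqP hW.1 hy, fun h0 => ⟨j, rfl,
      T.mem_of_wall_of_sub_eq_zero hs hqP hW hy h0⟩⟩
  · rintro _ rfl y hy
    exact ⟨hs.sub_nonneg hqP hW.1 hy, fun h0 => ⟨i, rfl,
      T.mem_of_wall_of_sub_eq_zero' hs hqP hW hy h0⟩⟩

/-- Four tiles around a common point, cyclically joined by walls, whose wall functionals satisfy
a linear relation with nonnegative coefficients, are decomposable. -/
theorem not_indecomposable_of_relation (T : ConvexTiling U P) (hs : Separating P h c) {q : E}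
    (hqP : ∀ i, q ∈ P i) {i j k l : Fin 4} (hij : Wall U P i j) (hjk : Wall U P j k)
    (hkl : Wall U P k l) (hil : Wall U P i l) (hik : i ≠ k) (hjl : j ≠ l)
    (hall : ∀ m, m = i ∨ m = j ∨ m = k ∨ m = l) {α β γ : ℝ} (hα : 0 ≤ α) (hβ : 0 < β) (hγ : 0 < γ)
    (hrel : ∀ v, γ * h j k v = β * h i l v + α * h i j v) : ¬ Indecomposable P := by
  intro hP
  have hij' := hij.1
  have hjk' := hjk.1
  have hkl' := hkl.1
  have hil' := hil.1
  -- For `α = 0` the functionals `h j k` and `h i l` are proportional, and their common hyperplane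
  -- separates `{i, j}` from `{k, l}`. For `α > 0` only `i` and `j` are merged: the relation extends
  -- the bound for `h j k` to `P i` and that for `h i l` to `P j`.
  rcases hα.eq_or_lt with rfl | hα
  · have hz : ∀ v, h i l v = 0 ↔ h j k v = 0 := by
      intro v
      have := hrel v
      constructor
      · intro h0
        rw [h0] at this
        simpa [hγ.ne'] using this
      · intro h0
        rw [h0] at this
        simpa [hβ.ne'] using this
    have hsep : Separated P {i, j} {k, l} := by
      refine separated_of_sub q (hs.ne_zero i l hil.1) ?_ ?_
      · rintro m (rfl | rfl) y hy
        · exact ⟨hs.sub_nonpos hqP hil.1 hy, fun h0 => ⟨l, by simp,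
            T.mem_of_wall_of_sub_eq_zero hs hqP hil hy h0⟩⟩
        · refine ⟨?_, fun h0 => ⟨k, by simp,
            T.mem_of_wall_of_sub_eq_zero hs hqP hjk hy ((hz _).1 h0)⟩⟩
          have h1 := hs.sub_nonpos hqP hjk.1 hy
          have := hrel (y - q)
          nlinarith
      · rintro m (rfl | rfl) y hy
        · refine ⟨?_, fun h0 => ⟨j, by simp,
            T.mem_of_wall_of_sub_eq_zero' hs hqP hjk hy ((hz _).1 h0)⟩⟩
          have h1 := hs.sub_nonneg hqP hjk.1 hy
          have := hrel (y - q)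
          nlinarith
        · exact ⟨hs.sub_nonneg hqP hil.1 hy, fun h0 => ⟨i, by simp,
            T.mem_of_wall_of_sub_eq_zero' hs hqP hil hy h0⟩⟩
    have hf : ∀ m, (if m = i ∨ m = j then i else k) = i ↔ m = i ∨ m = j := by
      intro m; split_ifs with h1 <;> simp [h1, hik.symm]
    have hI : {m | (if m = i ∨ m = j then i else k) = i} = ({i, j} : Set (Fin 4)) := by
      ext m; simp only [mem_ofPred_eq, hf]; simp
    have hK : {m | (if m = i ∨ m = j then i else k) = k} = ({k, l} : Set (Fin 4)) := by
      ext m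
      rcases hall m with rfl | rfl | rfl | rfl <;>
        simp_all [eq_comm]
    refine hP (fun m => if m = i ∨ m = j then i else k) (fun hinj => hij.1 (hinj (by simp)))
      ⟨i, k, by simp [hik, hik.symm, hjk.1.symm]⟩ fun a b hab => ?_
    by_cases ha : a = i ∨ a = j <;> by_cases hb : b = i ∨ b = j
    · simp [ha, hb] at hab
    · simp only [if_pos ha, if_neg hb, hI, hK]; exact hsep
    · simp only [if_neg ha, if_pos hb, hI, hK]; exact hsep.symm
    · simp [ha, hb] at hab
  · have hsk : Separated P {i, j} {k} := by
      refine separated_of_sub q (hs.ne_zero j k hjk.1) ?_ ?_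
      · rintro m (rfl | rfl) y hy
        · have h1 := hs.sub_nonpos hqP hil.1 hy
          have h2 := hs.sub_nonpos hqP hij.1 hy
          have h3 := hrel (y - q)
          refine ⟨by nlinarith, fun h0 => ⟨k, rfl, ?_⟩⟩
          rw [h0] at h3
          exact T.mem_of_wall_of_sub_eq_zero hs hqP hjk
            (T.mem_of_wall_of_sub_eq_zero hs hqP hij hy (by nlinarith)) h0
        · exact ⟨hs.sub_nonpos hqP hjk.1 hy, fun h0 => ⟨k, rfl,
            T.mem_of_wall_of_sub_eq_zero hs hqP hjk hy h0⟩⟩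
      · rintro m rfl y hy
        exact ⟨hs.sub_nonneg hqP hjk.1 hy, fun h0 => ⟨j, by simp,
          T.mem_of_wall_of_sub_eq_zero' hs hqP hjk hy h0⟩⟩
    have hsl : Separated P {i, j} {l} := by
      refine separated_of_sub q (hs.ne_zero i l hil.1) ?_ ?_
      · rintro m (rfl | rfl) y hy
        · exact ⟨hs.sub_nonpos hqP hil.1 hy, fun h0 => ⟨l, rfl,
            T.mem_of_wall_of_sub_eq_zero hs hqP hil hy h0⟩⟩
        · have h1 := hs.sub_nonpos hqP hjk.1 hy
          have h2 := hs.sub_nonneg hqP hij.1 hy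
          have h3 := hrel (y - q)
          refine ⟨by nlinarith, fun h0 => ⟨l, rfl, ?_⟩⟩
          rw [h0] at h3
          exact T.mem_of_wall_of_sub_eq_zero hs hqP hil
            (T.mem_of_wall_of_sub_eq_zero' hs hqP hij hy (by nlinarith)) h0
      · rintro m rfl y hy
        exact ⟨hs.sub_nonneg hqP hil.1 hy, fun h0 => ⟨i, by simp,
          T.mem_of_wall_of_sub_eq_zero' hs hqP hil hy h0⟩⟩
    have hskl : Separated P {k} {l} := T.separated_singleton_of_wall hs hqP hkl
    have hI : {m | (if m = i ∨ m = j then i else m) = i} = ({i, j} : Set (Fin 4)) := by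
      ext m
      rcases hall m with rfl | rfl | rfl | rfl <;> simp_all [eq_comm]
    have hK : {m | (if m = i ∨ m = j then i else m) = k} = ({k} : Set (Fin 4)) := by
      ext m
      rcases hall m with rfl | rfl | rfl | rfl <;> simp_all [eq_comm]
    have hL : {m | (if m = i ∨ m = j then i else m) = l} = ({l} : Set (Fin 4)) := by
      ext m
      rcases hall m with rfl | rfl | rfl | rfl <;> simp_all [eq_comm]
    have hβi : ∀ m, (if m = i ∨ m = j then i else m) = i ∨
        (if m = i ∨ m = j then i else m) = k ∨ (if m = i ∨ m = j then i else m) = l := by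
      intro m
      rcases hall m with rfl | rfl | rfl | rfl <;> simp_all [eq_comm]
    refine hP (fun m => if m = i ∨ m = j then i else m) (fun hinj => hij.1 (hinj (by simp)))
      ⟨i, k, by simp [hik, hik.symm, hjk.1.symm]⟩ fun a b hab => ?_
    rcases hβi a with ha | ha | ha <;> rcases hβi b with hb | hb | hb <;>
      simp only [ha, hb, hI, hK, hL] at hab ⊢
    exacts [absurd rfl hab, hsk, hsl, hsk.symm, absurd rfl hab, hskl, hsl.symm, hskl.symm,
      absurd rfl hab]

/-- The relation between three consecutive wall functionals of a cycle around a subspace of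
codimension two. -/
theorem exists_wall_relation (T : ConvexTiling U P) (hs : Separating P h c) {q : E}
    (hqP : ∀ i, q ∈ P i) {u u' : E →L[ℝ] ℝ}
    (hu : ∀ m n, Wall U P m n → ∀ v, u v = 0 → u' v = 0 → h m n v = 0)
    {i j k l : Fin 4} (hij : Wall U P i j) (hjk : Wall U P j k) (hil : Wall U P i l)
    (hik : i ≠ k) (hjl : j ≠ l) :
    ∃ α β γ : ℝ, 0 < β ∧ 0 < γ ∧ ∀ v, γ * h j k v = β * h i l v + α * h i j v := by
  obtain ⟨α, β, γ, hne, hrel⟩ := exists_linear_relation_of_ker_le (hu i j hij) (hu i l hil)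
    (hu j k hjk)
  obtain ⟨-, w, hw, hσ⟩ := id hij
  have hwi : w ∈ P i := (hσ i).2 (by simp)
  have hwj : w ∈ P j := (hσ j).2 (by simp)
  have h0 : h i j (w - q) = 0 :=
    le_antisymm (hs.sub_nonpos hqP hij.1 hwi) (hs.sub_nonneg hqP hij.1 hwj)
  -- At a point of exactly `P i` and `P j` the term `h i j` drops out and the other two functionals
  -- are strictly negative, which forces opposite nonzero signs on their coefficients.
  have h1 : h i l (w - q) < 0 := by
    refine lt_of_le_of_ne (hs.sub_nonpos hqP hil.1 hwi) fun h' => ?_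
    rcases (hσ l).1 (T.mem_of_wall_of_sub_eq_zero hs hqP hil hwi h') with h' | h'
    · exact hil.1 h'.symm
    · exact hjl h'.symm
  have h2 : h j k (w - q) < 0 := by
    refine lt_of_le_of_ne (hs.sub_nonpos hqP hjk.1 hwj) fun h' => ?_
    rcases (hσ k).1 (T.mem_of_wall_of_sub_eq_zero hs hqP hjk hwj h') with h' | h'
    · exact hik h'.symm
    · exact hjk.1 h'.symm
  have h3 := hrel (w - q)
  rw [h0, mul_zero, zero_add] at h3
  rcases lt_trichotomy β 0 with hβ | rfl | hβ
  · refine ⟨-α, -β, γ, by linarith, ?_, fun v => by linarith [hrel v]⟩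
    by_contra hγ
    nlinarith [mul_pos_of_neg_of_neg hβ h1, mul_nonneg_of_nonpos_of_nonpos (not_lt.1 hγ) h2.le]
  · exfalso
    rw [zero_mul, zero_add] at h3
    have hγ : γ = 0 := (mul_eq_zero.1 h3).resolve_right h2.ne
    have hα : α ≠ 0 := by simpa [hγ] using hne
    refine hs.ne_zero i j hij.1 (ContinuousLinearMap.ext fun v => ?_)
    have := hrel v
    simpa [hγ, hα] using this
  · refine ⟨α, β, -γ, hβ, ?_, fun v => by linarith [hrel v]⟩
    by_contra hγ
    nlinarith [mul_neg_of_pos_of_neg hβ h1,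
      mul_nonpos_of_nonneg_of_nonpos (show 0 ≤ γ by linarith) h2.le]

/-- Reading the cycle in the two directions gives two relations containing `h j k` and `h i l`. If
the third coefficient is nonnegative in one of them, `not_indecomposable_of_relation` applies; if
both are negative, evaluating on the wall of `j` and `k` gives `h i l` contradictory signs. -/
theorem not_indecomposable_of_cycle (T : ConvexTiling U P) (hs : Separating P h c) {q : E}
    (hqP : ∀ i, q ∈ P i) {u u' : E →L[ℝ] ℝ}
    (hu : ∀ m n, Wall U P m n → ∀ v, u v = 0 → u' v = 0 → h m n v = 0)
    {i j k l : Fin 4} (hij : Wall U P i j) (hjk : Wall U P j k) (hkl : Wall U P k l)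
    (hil : Wall U P i l) (hik : i ≠ k) (hjl : j ≠ l)
    (hall : ∀ m, m = i ∨ m = j ∨ m = k ∨ m = l) : ¬ Indecomposable P := by
  obtain ⟨α, β, γ, hβ, hγ, hrel⟩ := T.exists_wall_relation hs hqP hu hij hjk hil hik hjl
  obtain ⟨α', β', γ', hβ', hγ', hrel'⟩ :=
    T.exists_wall_relation hs hqP hu hkl.symm hjk.symm hil.symm hjl.symm hik.symm
  rcases le_or_gt 0 α with hα | hα
  · exact T.not_indecomposable_of_relation hs hqP hij hjk hkl hil hik hjl hall hα hβ hγ hrel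
  rcases le_or_gt 0 α' with hα' | hα'
  · exact T.not_indecomposable_of_relation hs hqP hkl.symm hjk.symm hij.symm hil.symm hjl.symm
      hik.symm (fun m => by have := hall m; tauto) hα' hβ' hγ' hrel'
  exfalso
  obtain ⟨-, w, hw, hσ⟩ := id hjk
  have hwj : w ∈ P j := (hσ j).2 (by simp)
  have hwk : w ∈ P k := (hσ k).2 (by simp)
  have h0 : h j k (w - q) = 0 :=
    le_antisymm (hs.sub_nonpos hqP hjk.1 hwj) (hs.sub_nonneg hqP hjk.1 hwk)
  have h1 : 0 < h i j (w - q) := by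
    refine lt_of_le_of_ne (hs.sub_nonneg hqP hij.1 hwj) fun h' => ?_
    rcases (hσ i).1 (T.mem_of_wall_of_sub_eq_zero' hs hqP hij hwj h'.symm) with h' | h'
    · exact hij.1 h'
    · exact hik h'
  have h2 : h k l (w - q) < 0 := by
    refine lt_of_le_of_ne (hs.sub_nonpos hqP hkl.1 hwk) fun h' => ?_
    rcases (hσ l).1 (T.mem_of_wall_of_sub_eq_zero hs hqP hkl hwk h') with h' | h'
    · exact hjl h'.symm
    · exact hkl.1 h'.symm
  have h3 := hrel (w - q)
  have h4 := hrel' (w - q)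
  rw [hs.neg j k hjk.1, hs.neg i l hil.1, hs.neg k l hkl.1] at h4
  simp only [neg_apply, h0] at h3 h4
  have h5 := mul_neg_of_neg_of_pos hα h1
  have h6 := mul_pos_of_neg_of_neg hα' h2
  have h7 : 0 < h i l (w - q) := by
    by_contra h8
    nlinarith [mul_nonpos_of_nonneg_of_nonpos hβ.le (not_lt.1 h8)]
  nlinarith [mul_pos hβ' h7]

/-- Dirac's theorem on four vertices: the hypothesis says that all degrees are at least two. A graph
is encoded by six Booleans, one per edge, and all cases are checked. -/
theorem exists_hamiltonian_cycle : ∀ r : Fin 4 → Fin 4 → Prop, (∀ i j, r i j → r j i) →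
    (∀ i j, i ≠ j → ∃ k, k ≠ j ∧ k ≠ i ∧ r i k) → ∃ i j k l, r i j ∧ r j k ∧ r k l ∧ r i l ∧
      i ≠ k ∧ j ≠ l ∧ ∀ m, m = i ∨ m = j ∨ m = k ∨ m = l := by
  intro r hsymm hdeg
  classical
  let t : Bool → Bool → Bool → Bool → Bool → Bool → Fin 4 → Fin 4 → Bool := fun a b c d e f =>
    ![![false, a, b, c], ![a, false, d, e], ![b, d, false, f], ![c, e, f, false]]
  have key : ∀ a b c d e f : Bool,
      (∀ i j, i ≠ j → ∃ k, k ≠ j ∧ t a b c d e f i k) → ∃ i j k l, t a b c d e f i j ∧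
        t a b c d e f j k ∧ t a b c d e f k l ∧ t a b c d e f i l ∧
        i ≠ k ∧ j ≠ l ∧ ∀ m, m = i ∨ m = j ∨ m = k ∨ m = l := by
    decide
  have hc : ∀ i j, r i j ↔ r j i := fun i j => ⟨hsymm i j, hsymm j i⟩
  have hs : ∀ i j, t (r 0 1) (r 0 2) (r 0 3) (r 1 2) (r 1 3) (r 2 3) i j = true ↔
      i ≠ j ∧ r i j := by
    intro i j
    fin_cases i <;> fin_cases j <;> simp [t, hc 1 0, hc 2 0, hc 3 0, hc 2 1, hc 3 1, hc 3 2]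
  obtain ⟨i, j, k, l, h1, h2, h3, h4, h5⟩ := key (r 0 1) (r 0 2) (r 0 3) (r 1 2) (r 1 3) (r 2 3)
    fun i j hij => by
      obtain ⟨k, hkj, hki, hk⟩ := hdeg i j hij
      exact ⟨k, hkj, (hs i k).2 ⟨hki.symm, hk⟩⟩
  exact ⟨i, j, k, l, ((hs _ _).1 h1).2, ((hs _ _).1 h2).2, ((hs _ _).1 h3).2,
    ((hs _ _).1 h4).2, h5⟩

/-- In an indecomposable tiling whose four tiles have a common point in the region, any three tiles
have a common point outside the fourth. -/
theorem exists_triple (T : ConvexTiling U P) (hP : Indecomposable P) {q : E} (hq : q ∈ U)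
    (hqP : ∀ i, q ∈ P i) (l : Fin 4) : ∃ x ∈ U, ∀ m, x ∈ P m ↔ m ≠ l := by
  by_contra hno
  obtain ⟨h, c, hs⟩ := T.exists_separating
  obtain ⟨u, u', hu⟩ := T.exists_ker_le_of_no_triple hs hq hqP hno
  obtain ⟨i, j, k, l, h1, h2, h3, h4, h5, h6, h7⟩ := exists_hamiltonian_cycle (Wall U P)
    (fun i j hW => hW.symm) fun i j hij => by
      obtain ⟨k, hk, hW⟩ := T.exists_second_wall hs hq hqP hij
      exact ⟨k, hk, hW.1.symm, hW⟩
  exact T.not_indecomposable_of_cycle hs hqP hu h1 h2 h3 h4 h5 h6 h7 hP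

end ConvexTiling

end ConvexTiling

/-! ### Classification of the pattern families. -/

section Combinatorics

/-- A family of subsets of four elements in which every element lies in a pair, every pair in a
triple, all nonempty subsets of triples belong to the family, and the full set is present iff all
triples are, is one of three simplicial complexes. -/
theorem exists_perm_of_pattern_family (K : Set (Finset (Fin 4))) (h0 : ∅ ∉ K)
    (hsub : ∀ l, {l}ᶜ ∈ K → ∀ s ⊆ {l}ᶜ, s.Nonempty → s ∈ K)
    (hquad : Finset.univ ∈ K ↔ ∀ l, {l}ᶜ ∈ K)
    (hvert : Finset.univ ∉ K → ∀ i, ∃ j, j ≠ i ∧ {i, j} ∈ K)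
    (hpair : Finset.univ ∉ K → ∀ i j, i ≠ j → {i, j} ∈ K → ∃ l, l ≠ i ∧ l ≠ j ∧ {l}ᶜ ∈ K) :
    ∃ (π : Equiv.Perm (Fin 4)) (f : Finset (Finset (Fin 4))),
      (f = PointConfig.tetrahedron ∨ f = PointConfig.threeTriangles ∨
        f = PointConfig.twoTriangles) ∧
      ∀ s : Finset (Fin 4), s.map π.toEmbedding ∈ K ↔ s.Nonempty ∧ ∃ t ∈ f, s ⊆ t := by
  classical
  by_cases hu : Finset.univ ∈ K
  · refine ⟨Equiv.refl _, _, Or.inl rfl, fun s => ?_⟩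
    rw [Equiv.refl_toEmbedding, Finset.map_refl]
    have ht : ∃ t ∈ PointConfig.tetrahedron, s ⊆ t := by revert s; decide
    refine ⟨fun h => ⟨Finset.nonempty_iff_ne_empty.2 fun h' => h0 (h' ▸ h), ht⟩, fun h => ?_⟩
    by_cases hs' : s = Finset.univ
    · rwa [hs']
    · obtain ⟨l, hl⟩ : ∃ l, l ∉ s := by
        by_contra hl
        push Not at hl
        exact hs' (Finset.eq_univ_iff_forall.2 hl)
      refine hsub l (hquad.1 hu l) s (fun i hi => ?_) h.1
      rw [Finset.mem_compl, Finset.mem_singleton]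
      rintro rfl
      exact hl hi
  -- The family is determined by the set `t` of vertices opposite to its triples. This set is not
  -- everything and has at least two elements, so up to relabelling it is `{1, 2, 3}` or `{2, 3}`.
  · let t : Finset (Fin 4) := Finset.univ.filter fun l => {l}ᶜ ∈ K
    have ht : ∀ l, l ∈ t ↔ {l}ᶜ ∈ K := fun l => by simp [t]
    have hK : ∀ s : Finset (Fin 4), s ∈ K ↔ s.Nonempty ∧ ∃ l ∈ t, l ∉ s := by
      intro s
      constructor
      · intro hs
        refine ⟨Finset.nonempty_iff_ne_empty.2 fun h' => h0 (h' ▸ hs), ?_⟩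
        have hcl : ∀ s : Finset (Fin 4), s = ∅ ∨ s = Finset.univ ∨ (∃ i, s = {i}) ∨
            (∃ i j, i ≠ j ∧ s = {i, j}) ∨ ∃ l, s = {l}ᶜ := by decide
        rcases hcl s with rfl | rfl | ⟨i, rfl⟩ | ⟨i, j, hij, rfl⟩ | ⟨l, rfl⟩
        · exact absurd hs h0
        · exact absurd hs hu
        · obtain ⟨j, hj, hij⟩ := hvert hu i
          obtain ⟨l, hl, -, hlK⟩ := hpair hu i j hj.symm hij
          exact ⟨l, (ht l).2 hlK, by simpa using hl⟩
        · obtain ⟨l, hl, hl', hlK⟩ := hpair hu i j hij hs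
          exact ⟨l, (ht l).2 hlK, by simp [hl, hl']⟩
        · exact ⟨l, (ht l).2 hs, by simp⟩
      · rintro ⟨hs, l, hl, hls⟩
        refine hsub l ((ht l).1 hl) s (fun i hi => ?_) hs
        rw [Finset.mem_compl, Finset.mem_singleton]
        rintro rfl
        exact hls hi
    have htu : t ≠ Finset.univ := fun h =>
      hu (hquad.2 fun l => (ht l).1 (h ▸ Finset.mem_univ l))
    have htc : ∀ i, ∃ l ∈ t, l ≠ i := by
      intro i
      obtain ⟨j, hj, hij⟩ := hvert hu i
      obtain ⟨l, hl, -, hlK⟩ := hpair hu i j hj.symm hij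
      exact ⟨l, (ht l).2 hlK, hl⟩
    have key : ∀ t : Finset (Fin 4), t ≠ Finset.univ → (∀ i, ∃ l ∈ t, l ≠ i) →
        ∃ π : Equiv.Perm (Fin 4), (∀ m, π m ∈ t ↔ m ∈ ({1, 2, 3} : Finset (Fin 4))) ∨
          ∀ m, π m ∈ t ↔ m ∈ ({2, 3} : Finset (Fin 4)) := by decide
    have hthree : ∀ s : Finset (Fin 4), (∃ m ∈ ({1, 2, 3} : Finset (Fin 4)), m ∉ s) ↔
        ∃ f ∈ PointConfig.threeTriangles, s ⊆ f := by decide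
    have htwo : ∀ s : Finset (Fin 4), (∃ m ∈ ({2, 3} : Finset (Fin 4)), m ∉ s) ↔
        ∃ f ∈ PointConfig.twoTriangles, s ⊆ f := by decide
    obtain ⟨π, hπ⟩ := key t htu htc
    have hmap : ∀ s : Finset (Fin 4), s.map π.toEmbedding ∈ K ↔
        s.Nonempty ∧ ∃ m, π m ∈ t ∧ m ∉ s := by
      intro s
      rw [hK, Finset.map_nonempty]
      refine and_congr_right fun _ => ⟨?_, ?_⟩
      · rintro ⟨l, hl, hls⟩
        exact ⟨π.symm l, by simpa using hl, fun h => hls (Finset.mem_map.2 ⟨_, h, by simp⟩)⟩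
      · rintro ⟨m, hm, hms⟩
        exact ⟨π m, hm, by simpa using hms⟩
    rcases hπ with hπ | hπ
    · exact ⟨π, _, Or.inr (Or.inl rfl), fun s => by simp only [hmap, hπ, hthree]⟩
    · exact ⟨π, _, Or.inr (Or.inr rfl), fun s => by simp only [hmap, hπ, htwo]⟩

end Combinatorics

/-! ### Patterns of an indecomposable tiling. -/

section ConvexTiling

open Set

variable {E : Type*} [NormedAddCommGroup E] [NormedSpace ℝ E]

namespace ConvexTiling

/-- The sets of indices of the tiles containing a common point of the region, and no further tile
containing that point. -/
def patterns {E : Type*} (U : Set E) (P : Fin 4 → Set E) : Set (Finset (Fin 4)) :=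
  {s | ∃ x ∈ U, ∀ i, x ∈ P i ↔ i ∈ s}

variable {U : Set E} {P : Fin 4 → Set E}

theorem Wall.mem_patterns {E : Type*} {U : Set E} {P : Fin 4 → Set E} {i j : Fin 4}
    (h : Wall U P i j) : {i, j} ∈ patterns U P := by
  obtain ⟨-, x, hx, hσ⟩ := h
  exact ⟨x, hx, fun k => by simp [hσ]⟩

theorem wall_of_mem_patterns {E : Type*} {U : Set E} {P : Fin 4 → Set E} {i j : Fin 4}
    (hij : i ≠ j) (h : {i, j} ∈ patterns U P) : Wall U P i j := by
  obtain ⟨x, hx, hσ⟩ := h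
  exact ⟨hij, x, hx, fun k => by simp [hσ]⟩

theorem mem_patterns_univ {E : Type*} {U : Set E} {P : Fin 4 → Set E} :
    Finset.univ ∈ patterns U P ↔ ∃ x ∈ U, ∀ i, x ∈ P i := by
  simp [patterns]

theorem mem_patterns_compl {E : Type*} {U : Set E} {P : Fin 4 → Set E} {l : Fin 4} :
    {l}ᶜ ∈ patterns U P ↔ ∃ x ∈ U, ∀ m, x ∈ P m ↔ m ≠ l := by
  simp [patterns]

/-- Since `U` is connected, `P i` meets another tile inside `U`; the meeting point misses some tile,
so `exists_wall_of_notMem` applies. -/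
theorem exists_wall (T : ConvexTiling U P) (hq : Finset.univ ∉ patterns U P) (i : Fin 4) :
    ∃ j, Wall U P i j := by
  obtain ⟨j, hj, -⟩ := exists_third i i
  obtain ⟨z, hz⟩ := T.nonempty_interior i
  obtain ⟨y, hy⟩ := T.nonempty_interior j
  obtain ⟨w, hw, hwi, m, hmi, hwm⟩ := T.exists_mem_inter_of_isPreconnected
    T.convex_region.isPreconnected subset_rfl (T.interior_subset_region i hz) (interior_subset hz)
    (T.interior_subset_region j hy) (fun h => (T.disjoint_interior hj).le_bot ⟨hy, h⟩)
  obtain ⟨n, hn⟩ : ∃ n, w ∉ P n := by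
    by_contra hall
    push Not at hall
    exact hq (mem_patterns_univ.2 ⟨w, hw, hall⟩)
  obtain ⟨k, -, hk⟩ := T.exists_wall_of_notMem (Ne.symm hmi) hw hwi hwm hn
  exact ⟨k, hk⟩

/-- The incidence patterns of an indecomposable tiling with four tiles form one of three simplicial
complexes. -/
theorem exists_perm_patterns (T : ConvexTiling U P) (hP : Indecomposable P) :
    ∃ (π : Equiv.Perm (Fin 4)) (f : Finset (Finset (Fin 4))),
      (f = PointConfig.tetrahedron ∨ f = PointConfig.threeTriangles ∨
        f = PointConfig.twoTriangles) ∧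
      ∀ s : Finset (Fin 4), s.map π.toEmbedding ∈ patterns U P ↔
        s.Nonempty ∧ ∃ t ∈ f, s ⊆ t := by
  refine exists_perm_of_pattern_family (patterns U P) ?_ ?_ ⟨?_, ?_⟩ ?_ ?_
  · rintro ⟨x, hx, hσ⟩
    obtain ⟨i, hi⟩ := T.exists_mem hx
    simpa using (hσ i).1 hi
  · intro l hl s hs hne
    have hcl : ∀ (l : Fin 4) (s : Finset (Fin 4)), s ⊆ {l}ᶜ → s.Nonempty → s = {l}ᶜ ∨
        (∃ i, s = {i}) ∨ ∃ i j k, i ≠ j ∧ i ≠ k ∧ j ≠ k ∧ s = {i, j} ∧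
          ∀ m, m ≠ l ↔ m = i ∨ m = j ∨ m = k := by decide
    rcases hcl l s hs hne with rfl | ⟨i, rfl⟩ | ⟨i, j, k, hij, hik, hjk, rfl, hall⟩
    · exact hl
    · obtain ⟨z, hz⟩ := T.nonempty_interior i
      refine ⟨z, T.interior_subset_region i hz, fun k => ?_⟩
      rw [Finset.mem_singleton]
      constructor
      · intro hk
        by_contra hki
        exact (T.disjoint_interior (Ne.symm hki)).le_bot ⟨hz, hk⟩
      · rintro rfl
        exact interior_subset hz
    · obtain ⟨x, hx, hσ⟩ := mem_patterns_compl.1 hl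
      exact (T.wall_of_three hij hik hjk hx fun m => by rw [hσ, hall]).mem_patterns
  · intro hq l
    obtain ⟨q, hqU, hqP⟩ := mem_patterns_univ.1 hq
    exact mem_patterns_compl.2 (T.exists_triple hP hqU hqP l)
  · intro hall
    refine mem_patterns_univ.2 (T.exists_mem_all_of_triples fun i => ?_)
    obtain ⟨x, hx, hσ⟩ := mem_patterns_compl.1 (hall i)
    exact ⟨x, hx, fun j hj => (hσ j).2 hj⟩
  · intro hq i
    obtain ⟨j, hW⟩ := T.exists_wall hq i
    exact ⟨j, hW.1.symm, hW.mem_patterns⟩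
  · intro hq i j hij h
    obtain ⟨w, hw, hwi, hwj, k, hki, hkj, hwk⟩ := T.exists_third_of_wall hP
      (wall_of_mem_patterns hij h)
    obtain ⟨l, hli, hlj, hlk, hall⟩ := exists_fourth i j k hij hki.symm hkj.symm
    refine ⟨l, hli, hlj, mem_patterns_compl.2 ⟨w, hw, fun m => ⟨?_, fun hm => ?_⟩⟩⟩
    · rintro hm rfl
      refine hq (mem_patterns_univ.2 ⟨w, hw, fun n => ?_⟩)
      rcases hall n with rfl | rfl | rfl | rfl <;> assumption
    · rcases hall m with rfl | rfl | rfl | rfl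
      exacts [hwi, hwj, hwk, absurd rfl hm]

end ConvexTiling

end ConvexTiling

/-! ### Supporting functionals and intrinsic interiors. -/

section Polytopes

open Set

/-- A point of a convex set outside its intrinsic interior lies on a supporting hyperplane that does
not contain the whole set. -/
theorem exists_support_of_notMem_intrinsicInterior {E : Type*} [NormedAddCommGroup E]
    [NormedSpace ℝ E] [FiniteDimensional ℝ E] {s : Set E} (hs : Convex ℝ s) {x : E} (hx : x ∈ s)
    (hxi : x ∉ intrinsicInterior ℝ s) :
    ∃ l : E →L[ℝ] ℝ, (∀ y ∈ s, l y ≤ l x) ∧ ∃ y ∈ s, l y < l x := by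
  let p : affineSpan ℝ s := ⟨x, subset_affineSpan ℝ s hx⟩
  have : Nonempty (affineSpan ℝ s) := ⟨p⟩
  let e := (AffineIsometryEquiv.vaddConst ℝ p).toHomeomorph
  have he : ∀ v, ((e v : affineSpan ℝ s) : E) = v + x := fun v => rfl
  -- Translated to the direction space of its affine span, the set has nonempty ordinary interior.
  -- Hahn–Banach applies there, and the functional is then extended to `E`.
  set s' : Set (affineSpan ℝ s).direction := e ⁻¹' ((↑) ⁻¹' s) with hs'
  have hmem : ∀ v, v ∈ s' ↔ (v : E) + x ∈ s := fun v => Iff.rfl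
  have hint : interior s' = e ⁻¹' interior ((↑) ⁻¹' s) := (e.preimage_interior _).symm
  have hcv : Convex ℝ s' := by
    intro v hv w hw a b ha hb hab
    rw [hmem] at hv hw ⊢
    have := hs hv hw ha hb hab
    convert this using 1
    have h1 : x = a • x + b • x := by rw [← add_smul, hab, one_smul]
    simp only [Submodule.coe_add, Submodule.coe_smul, smul_add]
    nth_rewrite 1 [h1]
    abel
  have hne : (interior s').Nonempty := by
    obtain ⟨_, y, hy, rfl⟩ := (intrinsicInterior_nonempty hs).2 ⟨x, hx⟩
    refine ⟨e.symm y, ?_⟩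
    rw [hint]
    simpa using hy
  have h0 : (0 : (affineSpan ℝ s).direction) ∉ interior s' := by
    intro h
    rw [hint] at h
    refine hxi ⟨e 0, h, ?_⟩
    rw [he]
    simp
  obtain ⟨f, hf, hle⟩ := geometric_hahn_banach_of_nonempty_interior_point hcv h0 hne
  obtain ⟨g, hg, -⟩ := exists_extension_norm_eq (𝕜 := ℝ) (affineSpan ℝ s).direction f
  rw [map_zero] at hle
  refine ⟨g, fun y hy => ?_, ?_⟩
  · have hd : y - x ∈ (affineSpan ℝ s).direction :=
      AffineSubspace.vsub_mem_direction (subset_affineSpan ℝ s hy) (subset_affineSpan ℝ s hx)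
    have h1 := hle ⟨y - x, hd⟩ (by rw [hmem]; simpa using hy)
    rw [← hg, map_sub] at h1
    linarith
  · obtain ⟨v, hv⟩ := hne
    refine ⟨v + x, (hmem v).1 (interior_subset hv), ?_⟩
    have := lt_of_mem_interior_of_le hf hle hv
    rw [← hg] at this
    rw [map_add]
    linarith

theorem exists_sub_smul_mem_of_mem_intrinsicInterior {E : Type*} [NormedAddCommGroup E]
    [NormedSpace ℝ E] {s : Set E} {x y : E} (hx : x ∈ intrinsicInterior ℝ s) (hy : y ∈ s) :
    ∃ ε : ℝ, 0 < ε ∧ x - ε • (y - x) ∈ s := by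
  obtain ⟨x, hx, rfl⟩ := hx
  have : Nonempty (affineSpan ℝ s) := ⟨x⟩
  let y' : affineSpan ℝ s := ⟨y, subset_affineSpan ℝ s hy⟩
  have hc : Continuous fun t : ℝ => AffineMap.lineMap (k := ℝ) x y' t :=
    AffineMap.lineMap_continuous
  have h0 : (fun t : ℝ => AffineMap.lineMap (k := ℝ) x y' t) ⁻¹' interior ((↑) ⁻¹' s) ∈
      nhds (0 : ℝ) := (isOpen_interior.preimage hc).mem_nhds (by simpa using hx)
  obtain ⟨r, hr, hb⟩ := Metric.mem_nhds_iff.1 h0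
  refine ⟨r / 2, by positivity, ?_⟩
  have h1 : -(r / 2) ∈ Metric.ball (0 : ℝ) r := by
    rw [Metric.mem_ball, dist_zero_right, Real.norm_eq_abs, abs_neg, abs_of_pos (by positivity)]
    linarith
  have h2 := interior_subset (hb h1)
  have h3 : ((AffineMap.lineMap (k := ℝ) x y' (-(r / 2)) : affineSpan ℝ s) : E) =
      x - (r / 2) • (y - x) := by
    rw [AffineMap.lineMap_apply]
    simp [y', sub_eq_add_neg, add_comm]
  rw [mem_preimage, h3] at h2
  exact h2

/-- A linear functional attaining its maximum over a set at an intrinsic interior point is constant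
on that set. -/
theorem eq_of_mem_intrinsicInterior_of_le {E : Type*} [NormedAddCommGroup E]
    [NormedSpace ℝ E] {s : Set E} {x y : E} (hx : x ∈ intrinsicInterior ℝ s) (hy : y ∈ s)
    {l : E →L[ℝ] ℝ} {c : ℝ} (hl : ∀ z ∈ s, l z ≤ c) (hxc : l x = c) : l y = c := by
  obtain ⟨ε, hε, hz⟩ := exists_sub_smul_mem_of_mem_intrinsicInterior hx hy
  refine le_antisymm (hl y hy) ?_
  have := hl _ hz
  rw [map_sub, map_smul, map_sub, smul_eq_mul, hxc] at this
  nlinarith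

end Polytopes

/-! ### Faces of configurations and cells of subdivisions. -/

namespace PointConfig

open Set

variable {d : ℕ} {ι : Type*} {a : ι → EuclideanSpace ℝ (Fin d)}

theorem hull_mono {F G : Set ι} (h : F ⊆ G) : hull a F ⊆ hull a G :=
  convexHull_mono (image_mono h)

theorem convex_hull (F : Set ι) : Convex ℝ (hull a F) := convex_convexHull ℝ _

theorem mem_hull {F : Set ι} {k : ι} (hk : k ∈ F) : a k ∈ hull a F :=
  subset_convexHull ℝ _ (mem_image_of_mem a hk)

theorem isClosed_hull [Finite ι] (F : Set ι) : IsClosed (hull a F) :=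
  (((toFinite F).image a).isCompact_convexHull ℝ).isClosed

theorem le_of_mem_hull {F : Set ι} {l : EuclideanSpace ℝ (Fin d) →L[ℝ] ℝ} {c : ℝ}
    (h : ∀ i ∈ F, l (a i) ≤ c) : ∀ y ∈ hull a F, l y ≤ c := by
  have : hull a F ⊆ {y | l y ≤ c} :=
    convexHull_min (by rintro _ ⟨i, hi, rfl⟩; exact h i hi)
      (convex_halfSpace_le l.toLinearMap.isLinear c)
  exact this

theorem ge_of_mem_hull {F : Set ι} {l : EuclideanSpace ℝ (Fin d) →L[ℝ] ℝ} {c : ℝ}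
    (h : ∀ i ∈ F, c ≤ l (a i)) : ∀ y ∈ hull a F, c ≤ l y := by
  have : hull a F ⊆ {y | c ≤ l y} :=
    convexHull_min (by rintro _ ⟨i, hi, rfl⟩; exact h i hi)
      (convex_halfSpace_ge l.toLinearMap.isLinear c)
  exact this

/-- The points that satisfy the inequality, and lie in the hull of the face in case of equality,
form a convex set containing all points of `C`. -/
theorem mem_hull_face {C : Set ι} {l : EuclideanSpace ℝ (Fin d) →L[ℝ] ℝ} {c : ℝ}
    (h : ∀ i ∈ C, l (a i) ≤ c) {x : EuclideanSpace ℝ (Fin d)} (hx : x ∈ hull a C) (hxc : l x = c) :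
    x ∈ hull a {i ∈ C | l (a i) = c} := by
  have : hull a C ⊆ {y | l y ≤ c ∧ (l y = c → y ∈ hull a {i ∈ C | l (a i) = c})} := by
    refine convexHull_min ?_ ?_
    · rintro _ ⟨i, hi, rfl⟩
      exact ⟨h i hi, fun hc => mem_hull (show i ∈ {i ∈ C | l (a i) = c} from ⟨hi, hc⟩)⟩
    · rintro y ⟨hy, hy'⟩ z ⟨hz, hz'⟩ p q hp hq hpq
      have h1 := mul_le_mul_of_nonneg_left hy hp
      have h2 := mul_le_mul_of_nonneg_left hz hq
      have h3 : p * c + q * c = c := by rw [← add_mul, hpq, one_mul]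
      simp only [mem_ofPred_eq, map_add, map_smul, smul_eq_mul]
      refine ⟨by linarith, fun he => ?_⟩
      rcases hp.eq_or_lt with rfl | hp'
      · obtain rfl : q = 1 := by linarith
        simpa using hz' (by linarith)
      rcases hq.eq_or_lt with rfl | hq'
      · obtain rfl : p = 1 := by linarith
        simpa using hy' (by linarith)
      · exact convex_hull _ (hy' (mul_left_cancel₀ hp'.ne' (by linarith)))
          (hz' (mul_left_cancel₀ hq'.ne' (by linarith))) hp hq hpq
  exact (this hx).2 hxc

theorem IsFace.subset {C F : Set ι} (h : IsFace a C F) : F ⊆ C := by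
  obtain ⟨-, l, c, -, rfl⟩ := h
  exact sep_subset _ _

theorem isFace_self {C : Set ι} (h : C.Nonempty) : IsFace a C C :=
  ⟨h, 0, 0, by simp, by simp⟩

/-- Adding a small positive multiple of the second functional to the first exposes `G` directly;
finiteness of `ι` lets one multiple keep all strict inequalities. -/
theorem IsFace.trans [Finite ι] {C F G : Set ι} (hF : IsFace a C F) (hG : IsFace a F G) :
    IsFace a C G := by
  obtain ⟨hFne, l, c, hl, rfl⟩ := hF
  obtain ⟨hne, l', c', hl', rfl⟩ := hG
  have hev : ∀ᶠ ε : ℝ in nhdsWithin 0 (Ioi 0), ∀ i, l (a i) < c →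
      l (a i) + ε * l' (a i) < c + ε * c' := by
    refine Filter.eventually_all.2 fun i => ?_
    by_cases hi : l (a i) < c
    · have h1 : Filter.Tendsto (fun ε : ℝ => l (a i) + ε * l' (a i)) (nhdsWithin 0 (Ioi 0))
          (nhds (l (a i) + 0 * l' (a i))) :=
        (Continuous.tendsto (by fun_prop) _).mono_left nhdsWithin_le_nhds
      have h2 : Filter.Tendsto (fun ε : ℝ => c + ε * c') (nhdsWithin 0 (Ioi 0))
          (nhds (c + 0 * c')) :=
        (Continuous.tendsto (by fun_prop) _).mono_left nhdsWithin_le_nhds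
      filter_upwards [h1.eventually_lt h2 (by simpa using hi)] with ε hε _ using hε
    · exact Filter.Eventually.of_forall fun _ h => absurd h hi
  obtain ⟨ε, hε, hpos⟩ := (hev.and self_mem_nhdsWithin).exists
  have hpos : 0 < ε := hpos
  refine ⟨hne, l + ε • l', c + ε * c', fun i hi => ?_, ?_⟩
  · simp only [add_apply, smul_apply, smul_eq_mul]
    rcases (hl i hi).lt_or_eq with h | h
    · exact (hε i h).le
    · have := mul_le_mul_of_nonneg_left (hl' i ⟨hi, h⟩) hpos.le
      linarith
  · ext i
    simp only [mem_ofPred_eq, add_apply, smul_apply,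
      smul_eq_mul]
    constructor
    · rintro ⟨⟨hi, h1⟩, h2⟩
      exact ⟨hi, by rw [h1, h2]⟩
    · rintro ⟨hi, h⟩
      rcases (hl i hi).lt_or_eq with h' | h'
      · exact absurd h (hε i h').ne
      · exact ⟨⟨hi, h'⟩, mul_left_cancel₀ hpos.ne' (by linarith)⟩

/-- Every point of a polytope lies in the intrinsic interior of a face. -/
theorem exists_isFace_mem_intrinsicInterior [Finite ι] {x : EuclideanSpace ℝ (Fin d)} :
    ∀ (n : ℕ) (C : Set ι), C.ncard = n → x ∈ hull a C →
      ∃ F, IsFace a C F ∧ x ∈ intrinsicInterior ℝ (hull a F) := by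
  intro n
  induction n using Nat.strong_induction_on with
  | _ n ih =>
    intro C hC hx
    by_cases hxi : x ∈ intrinsicInterior ℝ (hull a C)
    · refine ⟨C, isFace_self ?_, hxi⟩
      rw [nonempty_iff_ne_empty]
      rintro rfl
      simp [hull] at hx
    · obtain ⟨l, hl, y, hy, hlt⟩ :=
        exists_support_of_notMem_intrinsicInterior (convex_hull C) hx hxi
      have hl' : ∀ i ∈ C, l (a i) ≤ l x := fun i hi => hl _ (mem_hull hi)
      have hxF := mem_hull_face hl' hx rfl
      have hFne : {i ∈ C | l (a i) = l x}.Nonempty := by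
        rw [nonempty_iff_ne_empty]
        intro h
        simp [h, hull] at hxF
      have hF : IsFace a C {i ∈ C | l (a i) = l x} := ⟨hFne, l, l x, hl', rfl⟩
      -- The supporting functional is not constant on the hull, so the face through `x` has fewer
      -- labels and the induction applies.
      have hss : {i ∈ C | l (a i) = l x} ⊂ C := by
        refine (sep_subset _ _).ssubset_of_ne fun h => ?_
        have : ∀ i ∈ C, l x ≤ l (a i) := fun i hi => by
          rw [← h] at hi
          exact hi.2.ge
        exact absurd (ge_of_mem_hull this y hy) (not_le.2 hlt)
      obtain ⟨G, hG, hxG⟩ := ih _ (hC ▸ ncard_lt_ncard hss) _ rfl hxF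
      exact ⟨G, hF.trans hG, hxG⟩

theorem mem_of_isFace {C G F : Set ι} (hG : IsFace a C G) (hFC : F ⊆ C)
    {x : EuclideanSpace ℝ (Fin d)} (hxF : x ∈ intrinsicInterior ℝ (hull a F))
    (hxG : x ∈ hull a G) : F ⊆ G := by
  obtain ⟨-, l, c, hl, rfl⟩ := hG
  have hxc : l x = c := le_antisymm (le_of_mem_hull (fun i hi => hl i hi.1) x hxG)
    (ge_of_mem_hull (fun i hi => hi.2.ge) x hxG)
  exact fun i hi => ⟨hFC hi, eq_of_mem_intrinsicInterior_of_le hxF (mem_hull hi)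
    (le_of_mem_hull fun j hj => hl j (hFC hj)) hxc⟩

theorem IsFace.mem_of_mem_openSegment {C F : Set ι} (hF : IsFace a C F)
    {y z w : EuclideanSpace ℝ (Fin d)} (hy : y ∈ hull a C) (hz : z ∈ hull a C)
    (hw : w ∈ openSegment ℝ y z) (hwF : w ∈ hull a F) : y ∈ hull a F := by
  obtain ⟨-, l, c, hl, rfl⟩ := hF
  have hwc : l w = c := le_antisymm (le_of_mem_hull (fun i hi => hl i hi.1) w hwF)
    (ge_of_mem_hull (fun i hi => hi.2.ge) w hwF)
  refine mem_hull_face hl hy ?_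
  have h1 := le_of_mem_hull hl y hy
  have h2 := le_of_mem_hull hl z hz
  obtain ⟨p, q, hp, hq, hpq, rfl⟩ := hw
  rw [map_add, map_smul, map_smul, smul_eq_mul, smul_eq_mul] at hwc
  have h3 : p * c + q * c = c := by rw [← add_mul, hpq, one_mul]
  have h4 := mul_le_mul_of_nonneg_left h2 hq.le
  refine le_antisymm h1 (le_of_mul_le_mul_left ?_ hp)
  linarith

theorem IsFace.mem_of_mem_hull {C F : Set ι} (hF : IsFace a C F) {k : ι} (hk : k ∈ C)
    (hkF : a k ∈ hull a F) : k ∈ F := by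
  obtain ⟨-, l, c, hl, rfl⟩ := hF
  exact ⟨hk, le_antisymm (hl k hk) (ge_of_mem_hull (fun i hi => hi.2.ge) _ hkF)⟩

namespace IsSubdivision

variable {S : Set (Set ι)}

theorem eq_of_mem (hS : IsSubdivision a S) {F G : Set ι} (hF : F ∈ S) (hG : G ∈ S)
    {x : EuclideanSpace ℝ (Fin d)} (hxF : x ∈ intrinsicInterior ℝ (hull a F))
    (hxG : x ∈ intrinsicInterior ℝ (hull a G)) : F = G := by
  by_contra h
  exact (hS.disjoint_relint F hF G hG h).le_bot ⟨hxF, hxG⟩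

/-- Some face of `C` has `x` in its intrinsic interior. It is a cell too, so disjointness of
intrinsic interiors identifies it with `F`. -/
theorem isFace_of_mem [Finite ι] (hS : IsSubdivision a S) {C F : Set ι} (hC : C ∈ S) (hF : F ∈ S)
    {x : EuclideanSpace ℝ (Fin d)} (hxF : x ∈ intrinsicInterior ℝ (hull a F))
    (hxC : x ∈ hull a C) : IsFace a C F := by
  obtain ⟨G, hG, hxG⟩ := exists_isFace_mem_intrinsicInterior _ C rfl hxC
  rwa [hS.eq_of_mem hF (hS.face_mem C hC G hG) hxF hxG]

theorem exists_common_face [Finite ι] (hS : IsSubdivision a S) {C D : Set ι} (hC : C ∈ S)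
    (hD : D ∈ S) {x : EuclideanSpace ℝ (Fin d)} (hxC : x ∈ hull a C) (hxD : x ∈ hull a D) :
    ∃ F, x ∈ hull a F ∧ IsFace a C F ∧ IsFace a D F := by
  obtain ⟨F, hF, hxF⟩ := exists_isFace_mem_intrinsicInterior _ C rfl hxC
  exact ⟨F, intrinsicInterior_subset hxF, hF,
    hS.isFace_of_mem hD (hS.face_mem C hC F hF) hxF hxD⟩

theorem mem_of_mem_hull [Finite ι] (hS : IsSubdivision a S) {C D : Set ι} (hC : C ∈ S)
    (hD : D ∈ S) {k : ι} (hk : k ∈ C) (hkD : a k ∈ hull a D) : k ∈ D := by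
  obtain ⟨F, hkF, hCF, hDF⟩ := hS.exists_common_face hC hD (mem_hull hk) hkD
  exact hDF.subset (hCF.mem_of_mem_hull hk hkF)

theorem mem_hull_of_mem_openSegment [Finite ι] (hS : IsSubdivision a S) {C D : Set ι} (hC : C ∈ S)
    (hD : D ∈ S) {y z w : EuclideanSpace ℝ (Fin d)} (hy : y ∈ hull a C) (hz : z ∈ hull a C)
    (hw : w ∈ openSegment ℝ y z) (hwD : w ∈ hull a D) : y ∈ hull a D := by
  obtain ⟨F, hwF, hCF, hDF⟩ := hS.exists_common_face hC hD
    ((convex_hull C).openSegment_subset hy hz hw) hwD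
  exact hull_mono hDF.subset (hCF.mem_of_mem_openSegment hy hz hw hwF)

theorem exists_maximal [Finite ι] {F : Set ι} (hF : F ∈ S) : ∃ C ∈ maximalCells S, F ⊆ C := by
  obtain ⟨C, hFC, hC⟩ := (toFinite S).exists_le_maximal hF
  exact ⟨C, hC, hFC⟩

end IsSubdivision

theorem nonempty_interior_hull_univ (ha : affineSpan ℝ (range a) = ⊤) :
    (interior (hull a univ)).Nonempty := by
  rw [hull, image_univ]
  exact interior_convexHull_nonempty_iff_affineSpan_eq_top.2 ha

/-- The maximal cells of a subdivision are full-dimensional. -/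
theorem IsSubdivision.nonempty_interior [Finite ι] {S : Set (Set ι)} (hS : IsSubdivision a S)
    (ha : affineSpan ℝ (range a) = ⊤) {C : Set ι} (hC : C ∈ maximalCells S) :
    (interior (hull a C)).Nonempty := by
  have hfull : hull a univ ⊆ ⋃ F ∈ {F ∈ S | (interior (hull a F)).Nonempty}, hull a F := by
    have hcl : IsClosed (⋃ F ∈ {F ∈ S | (interior (hull a F)).Nonempty}, hull a F) :=
      (toFinite _).isClosed_biUnion fun F _ => isClosed_hull F
    have hint : interior (hull a univ) ⊆
        ⋃ F ∈ {F ∈ S | (interior (hull a F)).Nonempty}, hull a F := by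
      intro x hx
      by_contra hxn
      -- Cells with empty interior are nowhere dense, so the full-dimensional cells alone cover the
      -- polytope.
      have hd : Dense (⋂ F ∈ {F ∈ S | ¬ (interior (hull a F)).Nonempty}, (hull a F)ᶜ) := by
        refine dense_biInter_of_isOpen (fun F _ => (isClosed_hull F).isOpen_compl)
          (toFinite _).countable fun F hF => ?_
        rw [← interior_eq_empty_iff_dense_compl]
        exact not_nonempty_iff_eq_empty.1 hF.2
      obtain ⟨y, ⟨hyi, hyn⟩, hy⟩ := hd.inter_open_nonempty _
        (isOpen_interior.inter hcl.isOpen_compl) ⟨x, hx, hxn⟩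
      have hyS : y ∈ ⋃ F ∈ S, hull a F := hS.iUnion_hull ▸ interior_subset hyi
      simp only [mem_iUnion] at hyS
      obtain ⟨F, hF, hyF⟩ := hyS
      by_cases h : (interior (hull a F)).Nonempty
      · exact hyn (mem_biUnion (show F ∈ {F ∈ S | _} from ⟨hF, h⟩) hyF)
      · exact mem_iInter₂.1 hy F ⟨hF, h⟩ hyF
    have h1 := closure_minimal hint hcl
    rwa [(convex_hull univ).closure_interior_eq_closure_of_nonempty_interior
      (nonempty_interior_hull_univ ha), (isClosed_hull univ).closure_eq] at h1
  obtain ⟨x, hx⟩ := (intrinsicInterior_nonempty (convex_hull (a := a) C)).2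
    (by
      obtain ⟨k, hk⟩ := hS.nonempty C hC.1
      exact ⟨a k, mem_hull hk⟩)
  have hxG := hfull (hull_mono (subset_univ C) (intrinsicInterior_subset hx))
  simp only [mem_iUnion] at hxG
  obtain ⟨G, ⟨hG, hGi⟩, hxG⟩ := hxG
  have hCG := (hS.isFace_of_mem hG hC.1 hx hxG).subset
  rwa [hCG.antisymm (hC.2 hG hCG)]

end PointConfig

/-! ### From subdivisions to tilings and back. -/

namespace PointConfig

open Set

variable {d : ℕ} {ι : Type*} {a : ι → EuclideanSpace ℝ (Fin d)} {S : Set (Set ι)}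

theorem IsSubdivision.exists_maximal_mem_hull [Finite ι] (hS : IsSubdivision a S)
    {x : EuclideanSpace ℝ (Fin d)} (hx : x ∈ hull a univ) : ∃ C ∈ maximalCells S, x ∈ hull a C := by
  rw [← hS.iUnion_hull] at hx
  simp only [mem_iUnion] at hx
  obtain ⟨F, hF, hxF⟩ := hx
  obtain ⟨C, hC, hFC⟩ := IsSubdivision.exists_maximal hF
  exact ⟨C, hC, hull_mono hFC hxF⟩

/-- The maximal cells of a subdivision tile the interior of the polytope. -/
theorem IsSubdivision.convexTiling [Finite ι] (hS : IsSubdivision a S)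
    (ha : affineSpan ℝ (range a) = ⊤) {κ : Type*} (e : κ ≃ maximalCells S) :
    ConvexTiling (interior (hull a univ)) fun i => hull a (e i : Set ι) where
  isOpen := isOpen_interior
  convex_region := (convex_hull univ).interior
  isClosed i := isClosed_hull _
  convex i := convex_hull _
  nonempty_interior i := hS.nonempty_interior ha (e i).2
  disjoint i j hij := (hS.disjoint_relint _ (e i).2.1 _ (e j).2.1
    fun h => hij (e.injective (Subtype.ext h))).mono interior_subset_intrinsicInterior
      interior_subset_intrinsicInterior
  cover := by
    intro x hx
    obtain ⟨C, hC, hxC⟩ := hS.exists_maximal_mem_hull (interior_subset hx)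
    exact mem_iUnion.2 ⟨e.symm ⟨C, hC⟩, by simpa using hxC⟩
  interior_subset_region i := interior_mono (hull_mono (subset_univ _))
  extreme i j _ hy _ hz _ hw hwj :=
    hS.mem_hull_of_mem_openSegment (e i).2.1 (e j).2.1 hy hz hw hwj

/-- The faces of pairwise separated unions of maximal cells form a subdivision. -/
theorem IsSubdivision.merge [Finite ι] (hS : IsSubdivision a S) {κ : Type*}
    (e : κ ≃ maximalCells S) (β : κ → κ)
    (hsep : ∀ i j, β i ≠ β j → ConvexTiling.Separated (fun i => hull a (e i : Set ι))
      {k | β k = β i} {k | β k = β j}) :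
    IsSubdivision a {F | ∃ b, IsFace a {k | ∃ i, β i = b ∧ k ∈ (e i : Set ι)} F} where
  nonempty := by
    rintro F ⟨b, hF⟩
    exact hF.1
  face_mem := by
    rintro C ⟨b, hC⟩ F hF
    exact ⟨b, hC.trans hF⟩
  iUnion_hull := by
    refine subset_antisymm (iUnion₂_subset fun F _ => hull_mono (subset_univ F)) fun x hx => ?_
    obtain ⟨C, hC, hxC⟩ := hS.exists_maximal_mem_hull hx
    have hsub : C ⊆ {k | ∃ i, β i = β (e.symm ⟨C, hC⟩) ∧ k ∈ (e i : Set ι)} :=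
      fun k hk => ⟨e.symm ⟨C, hC⟩, rfl, by simpa using hk⟩
    exact mem_biUnion (show _ ∈ {F | ∃ b, IsFace a {k | ∃ i, β i = b ∧ k ∈ (e i : Set ι)} F} from
      ⟨_, isFace_self ((hS.nonempty C hC.1).mono hsub)⟩) (hull_mono hsub hxC)
  disjoint_relint := by
    have key : ∀ b b' F G, IsFace a {k | ∃ i, β i = b ∧ k ∈ (e i : Set ι)} F →
        IsFace a {k | ∃ i, β i = b' ∧ k ∈ (e i : Set ι)} G →
        ∀ x, x ∈ intrinsicInterior ℝ (hull a F) → x ∈ hull a G → F ⊆ G := by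
      intro b b' F G hF hG x hxF hxG
      refine mem_of_isFace hG ?_ hxF hxG
      by_cases hbb : b = b'
      · exact hbb ▸ hF.subset
      obtain ⟨k₁, hk₁⟩ := hF.1
      obtain ⟨k₂, hk₂⟩ := hG.1
      obtain ⟨i, rfl, -⟩ := hF.subset hk₁
      obtain ⟨j, rfl, -⟩ := hG.subset hk₂
      obtain ⟨l, c, -, h1, h2, h3, -⟩ := hsep i j hbb
      have hFc : ∀ k ∈ F, l (a k) ≤ c := by
        intro k hk
        obtain ⟨m, hm, hkm⟩ := hF.subset hk
        exact h1 m hm _ (mem_hull hkm)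
      have hGc : ∀ k ∈ G, c ≤ l (a k) := by
        intro k hk
        obtain ⟨m, hm, hkm⟩ := hG.subset hk
        exact h2 m hm _ (mem_hull hkm)
      have hxc : l x = c := le_antisymm
        (le_of_mem_hull hFc x (intrinsicInterior_subset hxF)) (ge_of_mem_hull hGc x hxG)
      -- The functional is maximal over `hull a F` at a relative interior point, so all of `F` lies
      -- on the separating hyperplane. There the two blocks agree as point sets, and
      -- `IsSubdivision.mem_of_mem_hull` turns this into agreement of labels.
      intro k hk
      have hkc := eq_of_mem_intrinsicInterior_of_le hxF (mem_hull hk) (le_of_mem_hull hFc) hxc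
      obtain ⟨m, hm, hkm⟩ := hF.subset hk
      obtain ⟨n, hn, hkn⟩ := h3 m hm _ (mem_hull hkm) hkc
      exact ⟨n, hn, hS.mem_of_mem_hull (e m).2.1 (e n).2.1 hkm hkn⟩
    rintro F ⟨b, hF⟩ G ⟨b', hG⟩ hne
    rw [Set.disjoint_left]
    intro x hxF hxG
    exact hne ((key b b' F G hF hG x hxF (intrinsicInterior_subset hxG)).antisymm
      (key b' b G F hG hF x hxG (intrinsicInterior_subset hxF)))

/-- Merging the blocks gives a coarsening. If it equals `S`, each block is a single cell and the
grouping is injective; if it is trivial, one block contains all labels, although a hyperplane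
separates it from the interior of another tile. -/
theorem IsCoarsestSubdivision.indecomposable [Finite ι] (hS : IsCoarsestSubdivision a S)
    (ha : affineSpan ℝ (range a) = ⊤) {κ : Type*} (e : κ ≃ maximalCells S) :
    ConvexTiling.Indecomposable fun i => hull a (e i : Set ι) := by
  intro β hinj hconst hsep
  have hsub := hS.isSubdivision
  have hblock : ∀ i, (e i : Set ι) ⊆ {k | ∃ j, β j = β i ∧ k ∈ (e j : Set ι)} :=
    fun i k hk => ⟨i, rfl, hk⟩
  have hmem : ∀ i, {k | ∃ j, β j = β i ∧ k ∈ (e j : Set ι)} ∈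
      {F | ∃ b, IsFace a {k | ∃ i, β i = b ∧ k ∈ (e i : Set ι)} F} := fun i =>
    ⟨_, isFace_self ((hsub.nonempty _ (e i).2.1).mono (hblock i))⟩
  have href : Refines S {F | ∃ b, IsFace a {k | ∃ i, β i = b ∧ k ∈ (e i : Set ι)} F} := by
    intro F hF
    obtain ⟨C, hC, hFC⟩ := IsSubdivision.exists_maximal hF
    refine ⟨_, hmem (e.symm ⟨C, hC⟩), hFC.trans ?_⟩
    simpa using hblock (e.symm ⟨C, hC⟩)
  rcases hS.eq_or_eq_trivial _ (hsub.merge e β hsep) href with hT | hT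
  · refine hinj fun i j hij => e.injective (Subtype.ext ?_)
    have key : ∀ i, (e i : Set ι) = {k | ∃ j, β j = β i ∧ k ∈ (e j : Set ι)} := by
      intro i
      have h := hmem i
      rw [hT] at h
      exact (hblock i).antisymm ((e i).2.2 h (hblock i))
    rw [key i, key j, hij]
  · obtain ⟨i, j, hij⟩ := hconst
    obtain ⟨k, -⟩ := hsub.nonempty _ (e i).2.1
    have huniv : univ ∈ trivialSubdivision a := isFace_self ⟨k, mem_univ k⟩
    rw [← hT] at huniv
    obtain ⟨b, hb⟩ := huniv
    obtain ⟨m, rfl, -⟩ := hb.subset (mem_univ k)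
    obtain ⟨n, hn⟩ : ∃ n, β m ≠ β n := by
      by_contra h
      push Not at h
      exact hij ((h i).symm.trans (h j))
    obtain ⟨l, c, hl, h1, h2, -⟩ := hsep m n hn
    obtain ⟨z, hz⟩ := hsub.nonempty_interior ha (e n).2
    refine absurd (le_of_mem_hull (F := univ) (fun k _ => ?_) z
      (hull_mono (subset_univ _) (interior_subset hz)))
      (not_le.2 (lt_of_mem_interior_of_ge hl (h2 n rfl) hz))
    obtain ⟨p, hp, hkp⟩ := hb.subset (mem_univ k)
    exact h1 p hp _ (mem_hull hkp)

/-- A functional supporting the polytope at a relative interior point of `F` is constant on `hull a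
F`, which would put all of it in the boundary. -/
theorem mem_interior_of_mem_interiorFaces (ha : affineSpan ℝ (range a) = ⊤) {F : Set ι}
    (hF : F ∈ interiorFaces a S) {x : EuclideanSpace ℝ (Fin d)}
    (hx : x ∈ intrinsicInterior ℝ (hull a F)) : x ∈ interior (hull a univ) := by
  by_contra hxi
  obtain ⟨l, hl, hle⟩ := geometric_hahn_banach_of_nonempty_interior_point (convex_hull univ) hxi
    (nonempty_interior_hull_univ ha)
  refine hF.2 fun y hy => ⟨subset_closure (hull_mono (subset_univ F) hy), fun hyi => ?_⟩
  have h1 := eq_of_mem_intrinsicInterior_of_le hx hy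
    (fun z hz => hle z (hull_mono (subset_univ F) hz)) rfl
  exact absurd h1 (lt_of_mem_interior_of_le hl hle hyi).ne

theorem mem_interiorFaces_of_mem {F : Set ι} (hF : F ∈ S) {x : EuclideanSpace ℝ (Fin d)}
    (hx : x ∈ hull a F) (hxi : x ∈ interior (hull a univ)) : F ∈ interiorFaces a S :=
  ⟨hF, fun h => (h hx).2 hxi⟩

/-- An interior face contains every label common to all maximal cells above it. -/
theorem IsSubdivision.mem_of_forall_maximal [Finite ι] (hS : IsSubdivision a S)
    (ha : affineSpan ℝ (range a) = ⊤) {κ : Type*} [Finite κ] (e : κ ≃ maximalCells S) {F : Set ι}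
    (hF : F ∈ interiorFaces a S) {k : ι}
    (hk : ∀ i, F ⊆ (e i : Set ι) → k ∈ (e i : Set ι)) : k ∈ F := by
  obtain ⟨x, hx⟩ := (intrinsicInterior_nonempty (convex_hull (a := a) F)).2
    (by
      obtain ⟨k, hk⟩ := hS.nonempty F hF.1
      exact ⟨a k, mem_hull hk⟩)
  have T := hS.convexTiling ha e
  obtain ⟨r, hr, hBU, hB⟩ := T.exists_ball (mem_interior_of_mem_interiorFaces ha hF hx)
  -- The segment from `a k` is prolonged slightly beyond `x`. A tile containing the new endpoint has
  -- `F` as a face and contains `k`, and `x` lies between two of its points, so `a k` is in `hull a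
  -- F`.
  obtain ⟨ε, hε, -, hb⟩ := exists_forall_abs_le_add_smul_mem Metric.isOpen_ball
    (Metric.mem_ball_self (x := x) hr) (x - a k)
  have hb' := hb ε (abs_of_pos hε).le
  obtain ⟨i, hi⟩ := T.exists_mem (hBU hb')
  have hface := hS.isFace_of_mem (e i).2.1 hF.1 hx (hB _ hb' i hi)
  have hki := hk i hface.subset
  refine hface.mem_of_mem_hull hki (hface.mem_of_mem_openSegment (mem_hull hki) hi
    (w := x) ?_ (intrinsicInterior_subset hx))
  refine ⟨ε / (1 + ε), 1 / (1 + ε), by positivity, by positivity, by field_simp; ring, ?_⟩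
  have : (1 + ε) ≠ 0 := by positivity
  apply smul_right_injective _ this
  simp only [smul_add, smul_smul]
  field_simp
  module

/-- The tight span of a subdivision with four maximal cells is isomorphic to the complex of its
incidence patterns. -/
theorem IsSubdivision.nonempty_orderIso [Finite ι] (hS : IsSubdivision a S)
    (ha : affineSpan ℝ (range a) = ⊤) (e : Fin 4 ≃ maximalCells S) (π : Equiv.Perm (Fin 4))
    (f : Finset (Finset (Fin 4)))
    (hf : ∀ s : Finset (Fin 4), s.map π.toEmbedding ∈
      ConvexTiling.patterns (interior (hull a univ)) (fun i => hull a (e i : Set ι)) ↔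
        s.Nonempty ∧ ∃ t ∈ f, s ⊆ t) : Nonempty (TightSpan a S ≃o FacePoset f) := by
  classical
  have T := hS.convexTiling ha e
  -- A face goes to the set of maximal cells containing it, which is the pattern of any of its
  -- relative interior points, relabelled by `π`.
  let φ : Set ι → Finset (Fin 4) := fun F => Finset.univ.filter fun i => F ⊆ (e (π i) : Set ι)
  have hφ : ∀ F i, i ∈ φ F ↔ F ⊆ (e (π i) : Set ι) := fun F i => by simp [φ]
  have hσ : ∀ F ∈ S, ∀ x ∈ intrinsicInterior ℝ (hull a F), ∀ i,
      x ∈ hull a (e i : Set ι) ↔ F ⊆ (e i : Set ι) := fun F hF x hx i =>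
    ⟨fun h => (hS.isFace_of_mem (e i).2.1 hF hx h).subset,
      fun h => hull_mono h (intrinsicInterior_subset hx)⟩
  have hmem : ∀ F ∈ interiorFaces a S, (φ F).Nonempty ∧ ∃ t ∈ f, φ F ⊆ t := by
    intro F hF
    rw [← hf]
    obtain ⟨x, hx⟩ := (intrinsicInterior_nonempty (convex_hull (a := a) F)).2
      (by
        obtain ⟨k, hk⟩ := hS.nonempty F hF.1
        exact ⟨a k, mem_hull hk⟩)
    refine ⟨x, mem_interior_of_mem_interiorFaces ha hF hx, fun i => ?_⟩
    rw [hσ F hF.1 x hx, ← Finset.mem_coe]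
    simp only [Finset.coe_map, mem_image, Finset.mem_coe, hφ]
    constructor
    · intro h
      exact ⟨π.symm i, by simpa using h, by simp⟩
    · rintro ⟨j, hj, rfl⟩
      exact hj
  let ψ : TightSpan a S → FacePoset f := fun F =>
    ⟨φ (OrderDual.ofDual F).1, hmem _ (OrderDual.ofDual F).2⟩
  have hle : ∀ F G : TightSpan a S, ψ F ≤ ψ G ↔ F ≤ G := by
    intro F G
    constructor
    · intro h k hk
      refine hS.mem_of_forall_maximal ha e (OrderDual.ofDual F).2 fun i hi => ?_
      have h1 : π.symm i ∈ φ (OrderDual.ofDual F).1 := by rw [hφ]; simpa using hi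
      have h2 := (hφ _ _).1 (h h1)
      simp only [Equiv.apply_symm_apply] at h2
      exact h2 hk
    · intro h i hi
      rw [hφ] at hi ⊢
      exact Subset.trans (show (OrderDual.ofDual G).1 ⊆ (OrderDual.ofDual F).1 from h) hi
  refine ⟨RelIso.ofSurjective (OrderEmbedding.ofMapLEIff ψ hle) ?_⟩
  rintro ⟨s, hs⟩
  obtain ⟨x, hx, hxs⟩ := (hf s).2 hs
  obtain ⟨i, hi⟩ := T.exists_mem hx
  obtain ⟨F, hF, hxF⟩ := exists_isFace_mem_intrinsicInterior _ _ rfl hi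
  have hFS := hS.face_mem _ (e i).2.1 F hF
  refine ⟨OrderDual.toDual ⟨F, mem_interiorFaces_of_mem hFS (intrinsicInterior_subset hxF) hx⟩,
    Subtype.ext ?_⟩
  ext j
  refine (hφ F j).trans ?_
  rw [← hσ F hFS x hxF, hxs]
  simp

end PointConfig

theorem mainTheorem12 {d : ℕ} {ι : Type*} [Finite ι]
    (a : ι → EuclideanSpace ℝ (Fin d)) (ha : affineSpan ℝ (Set.range a) = ⊤)
    (S : Set (Set ι)) (hS : PointConfig.IsKSubdivision a 4 S) :
    Nonempty (PointConfig.TightSpan a S ≃o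
        PointConfig.FacePoset PointConfig.tetrahedron) ∨
      Nonempty (PointConfig.TightSpan a S ≃o
        PointConfig.FacePoset PointConfig.threeTriangles) ∨
      Nonempty (PointConfig.TightSpan a S ≃o
        PointConfig.FacePoset PointConfig.twoTriangles) := by
  have hsub := hS.isCoarsest.isSubdivision
  have hcard : (PointConfig.maximalCells S).ncard = 4 := by
    rw [Set.ncard, hS.encard_maximalCells]
    rfl
  have e : Fin 4 ≃ PointConfig.maximalCells S :=
    (Finite.equivFinOfCardEq hcard).symm
  obtain ⟨π, f, h, hf⟩ := (hsub.convexTiling ha e).exists_perm_patterns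
    (hS.isCoarsest.indecomposable ha e)
  have hiso := hsub.nonempty_orderIso ha e π f hf
  rcases h with rfl | rfl | rfl
  · exact Or.inl hiso
  · exact Or.inr (Or.inl hiso)
  · exact Or.inr (Or.inr hiso)
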